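/- For $N\ge 1$ and $x\in\mathbb C\setminus[0,\infty)$ let $$W_1(x)=\frac1{\mathcal Z}\int_{[0,\infty)^N}\Bigl(\sum_{i=1}^N\frac1{x-\lambda_i}\Bigr)e^{-N\sum_i\lambda_i}\prod_{i<j}(\lambda_i-\lambda_j)^2\,d\lambda_1\cdots d\lambda_N,\qquad \mathcal Z=\int_{[0,\infty)^N}e^{-N\sum_i\lambda_i}\prod_{i<j}(\lambda_i-\lambda_j)^2\,d\lambda_1\cdots d\lambda_N,$$ be the one-loop mean of the $N\times N$ Laguerre ensemble. For every $x\in\mathbb C\setminus[0,\infty)$ with $|x|>4$ it has an asymptotic expansion $W_1(x)\sim\sum_{g\ge0}N^{1-2g}W_1^{(g)}(x)$ as $N\to\infty$, that is, for each $G\ge0$, $$W_1(x)-\sum_{g=0}^{G}N^{1-2g}W_1^{(g)}(x)=O(N^{-1-2G}),$$ and there are numbers $C_n^{(g)}$ ($n,g\ge0$) such that, for all such $x$, $W_1^{(g)}(x)=\sum_{n\ge0}C_n^{(g)}x^{-1-2g-n}$ (a convergent series). Moreover, whenever these two expansions hold for all $x\in\mathbb C\setminus[0,\infty)$ with $|x|>R$,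 for some real $R$, the coefficients satisfy the three-term recursion $$(n+2g+1)\,C_n^{(g)}=(n+2g-2)(n+2g-1)^2\,C_n^{(g-1)}+2(2n+4g-1)\,C_{n-1}^{(g)},\qquad n>0,\ g>0,$$ and $$C_0^{(0)}=1,\qquad C_0^{(g)}=0\quad(g\ge1),\qquad C_1^{(g)}=\frac{2^g\,g!\,(2g-1)!!}{g+1}\quad(g\ge0),$$ where $(-1)!!=1$. -/

import Mathlib

open scoped Nat

noncomputable section

namespace Laguerre

/-- The unnormalised joint density `exp (-N ∑ λᵢ) Δ(λ)²` of the eigenvalues in the `N × N` Laguerre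
ensemble, where `Δ(λ) = ∏_{i<j} (λᵢ - λⱼ)`. -/
def weight (N : ℕ) (l : Fin N → ℝ) : ℝ :=
  Real.exp (-(N : ℝ) * ∑ i, l i) * (∏ i, ∏ j ∈ Finset.Ioi i, (l i - l j)) ^ 2

/-- The domain `[0, ∞)^N` of the eigenvalues. -/
def domain (N : ℕ) : Set (Fin N → ℝ) := {l | ∀ i, 0 ≤ l i}

/-- The normalising constant `Z`. -/
def partitionFunction (N : ℕ) : ℝ :=
  ∫ l in domain N, weight N l

/-- The one-loop mean `W₁(x) = ⟨tr (x - H)⁻¹⟩` at matrix size `N`. It is meant for `x` in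
`ℂ \ [0, ∞)`, where the integrand is a bounded function times the integrable weight. -/
def oneLoopMean (N : ℕ) (x : ℂ) : ℂ :=
  ((partitionFunction N : ℝ) : ℂ)⁻¹ *
    ∫ l in domain N, ((weight N l : ℝ) : ℂ) * ∑ i, (x - ((l i : ℝ) : ℂ))⁻¹

/-- The neighbourhood `|x| > R` of infinity in `ℂ`, with the half-line `[0, ∞)` removed. -/
def cutNhd (R : ℝ) : Set ℂ :=
  {x | R < ‖x‖ ∧ ∀ t : ℝ, 0 ≤ t → x ≠ (t : ℂ)}

/-- The functions `W g = W₁^{(g)}` are the terms of the genus (that is, `1/N`) expansion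
`W₁(x) ~ ∑_g N^{1-2g} W₁^{(g)}(x)`, an asymptotic expansion as `N → ∞`, for each `x` off the
half-line with `|x| > R`. -/
def IsGenusExpansion (R : ℝ) (W : ℕ → ℂ → ℂ) : Prop :=
  ∀ x ∈ cutNhd R, ∀ G : ℕ,
    Asymptotics.IsBigO Filter.atTop
      (fun N : ℕ => oneLoopMean N x -
        ∑ g ∈ Finset.range (G + 1), (N : ℂ) ^ (1 - 2 * (g : ℤ)) * W g x)
      (fun N : ℕ => (N : ℝ) ^ (-1 - 2 * (G : ℤ)))

/-- The numbers `C g n = C_n^{(g)}` are the coefficients in the convergent expansions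
`W₁^{(g)}(x) = ∑_{n ≥ 0} C_n^{(g)} x^{-1-2g-n}` for `x` off the half-line with `|x| > R`. -/
def IsCoefficients (R : ℝ) (W : ℕ → ℂ → ℂ) (C : ℕ → ℕ → ℂ) : Prop :=
  ∀ g : ℕ, ∀ x ∈ cutNhd R,
    HasSum (fun n : ℕ => C g n * x ^ (-1 - 2 * (g : ℤ) - (n : ℤ))) (W g x)

end Laguerre

end

/-! The mean W₁ is the Stieltjes transform of the one-point density, which by orthogonality is a sum
of squares of Laguerre functions. Integration by parts and the Laguerre relations yield the
Haagerup–Thorbjørnsen recursion (`unscaledMoment_recurrence`). After rescaling, `N` enters it only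
through ε = N⁻², so each moment is a polynomial in ε whose coefficients `genusCoeff k g` obey a
recursion of their own. Setting k = n + 2g turns that recursion into the stated one, with C_n^{(g)}
= `genusCoeff (n + 2g) g`.

The analytic difficulty is that for fixed `N` the moments grow factorially, so the moment series of
W₁ diverges. It is cut at K ≈ √N terms. For k ≤ K the moments, and the remainders of their
ε-expansions, still grow only like 4^k times powers of k, up to the factor exp(εK³), which stays
bounded (`genusRemainder_bound`). Since |x| > 4, everything beyond K is smaller than any power of
`N` (`genusExpansion_error_bound`).

The claims about arbitrary expansions then follow from uniqueness: first of asymptotic coefficients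
in `N`, then of Laurent coefficients at infinity (`coefficients_eq`). -/

noncomputable section

namespace Laguerre

/-! ### Laguerre polynomials and the moment recursion -/

section LaguerrePolynomials

open Polynomial

/-- The linear functional `X ^ n ↦ n!`, that is, `p ↦ ∫₀^∞ p(t) e⁻ᵗ dt`. -/
def gammaFunctional : ℝ[X] →ₗ[ℝ] ℝ :=
  Polynomial.lsum fun n => (n ! : ℝ) • LinearMap.id

lemma gammaFunctional_monomial (n : ℕ) (a : ℝ) :
    gammaFunctional (monomial n a) = n ! * a := by
  simp [gammaFunctional, Polynomial.lsum_apply, Polynomial.sum_monomial_index]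

/-- Integration by parts against e⁻ᵗ, checked on monomials. -/
lemma gammaFunctional_derivative (q : ℝ[X]) :
    gammaFunctional (derivative q) = gammaFunctional q - q.coeff 0 := by
  induction q using Polynomial.induction_on' with
  | add p q hp hq => simp only [map_add, coeff_add, hp, hq]; ring
  | monomial n a =>
    cases n with
    | zero => rw [derivative_monomial, gammaFunctional_monomial, gammaFunctional_monomial]; simp
    | succ n =>
      rw [derivative_monomial, gammaFunctional_monomial, gammaFunctional_monomial,
        coeff_monomial, Nat.factorial_succ]
      push_cast
      simp
      ring

lemma gammaFunctional_X_mul_derivative (q : ℝ[X]) :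
    gammaFunctional (X * derivative q) = gammaFunctional (X * q) - gammaFunctional q := by
  have h := gammaFunctional_derivative (X * q)
  simp only [derivative_mul, derivative_X, one_mul, map_add, mul_coeff_zero, coeff_X_zero,
    zero_mul, sub_zero] at h
  linarith

lemma gammaFunctional_C_mul (a : ℝ) (q : ℝ[X]) :
    gammaFunctional (C a * q) = a * gammaFunctional q := by
  rw [← smul_eq_C_mul, map_smul, smul_eq_mul]

/-- The Laguerre polynomial of degree `n` (with parameter `0`). -/
def laguerrePoly (n : ℕ) : ℝ[X] :=
  ∑ k ∈ Finset.range (n + 1), monomial k ((-1 : ℝ) ^ k * n.choose k / k !)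

lemma coeff_laguerrePoly (n k : ℕ) :
    (laguerrePoly n).coeff k = (-1 : ℝ) ^ k * n.choose k / k ! := by
  simp only [laguerrePoly, finsetSum_coeff, coeff_monomial]
  rw [Finset.sum_ite_eq']
  split_ifs with h
  · rfl
  · rw [Nat.choose_eq_zero_of_lt (by simpa using h)]; simp

lemma laguerrePoly_zero : laguerrePoly 0 = 1 := by
  simp [laguerrePoly]

/-- Pascal's rule on coefficients. With the next relation, which also uses the absorption identity
for binomials, it yields every Laguerre identity needed below. -/
lemma derivative_laguerrePoly_succ (n : ℕ) :
    derivative (laguerrePoly (n + 1)) = derivative (laguerrePoly n) - laguerrePoly n := by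
  ext k
  simp only [coeff_derivative, coeff_sub, coeff_laguerrePoly]
  rw [Nat.choose_succ_succ, Nat.factorial_succ]
  have : (k ! : ℝ) ≠ 0 := by positivity
  push_cast
  field_simp
  ring

lemma X_mul_derivative_laguerrePoly_succ (n : ℕ) :
    X * derivative (laguerrePoly (n + 1)) =
      C ((n : ℝ) + 1) * (laguerrePoly (n + 1) - laguerrePoly n) := by
  ext k
  rw [coeff_C_mul, coeff_sub]
  cases k with
  | zero => simp [coeff_laguerrePoly]
  | succ k =>
    rw [coeff_X_mul]
    simp only [coeff_derivative, coeff_laguerrePoly]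
    have h := Nat.add_one_mul_choose_eq n k
    have h' := Nat.choose_succ_succ n k
    rw [Nat.factorial_succ]
    have : (k ! : ℝ) ≠ 0 := by positivity
    have e : ((n : ℝ) + 1) * n.choose k = (n + 1).choose (k + 1) * (k + 1) := by exact_mod_cast h
    have e' : ((n + 1).choose (k + 1) : ℝ) = n.choose k + n.choose (k + 1) := by exact_mod_cast h'
    push_cast
    field_simp
    linear_combination -(e) - (↑n + 1) * e'

/-- The three-term recurrence of the Laguerre polynomials. -/
lemma laguerrePoly_recurrence (n : ℕ) :
    C ((n : ℝ) + 1) * laguerrePoly (n + 1) + C (n : ℝ) * laguerrePoly (n - 1) =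
      C (2 * (n : ℝ) + 1) * laguerrePoly n - X * laguerrePoly n := by
  have h1 := X_mul_derivative_laguerrePoly_succ n
  rw [derivative_laguerrePoly_succ] at h1
  have h2 : X * derivative (laguerrePoly n) = C (n : ℝ) * (laguerrePoly n - laguerrePoly (n - 1)) := by
    cases n with
    -- The truncated index `0 - 1 = 0` is harmless, since its coefficient vanishes.
    | zero => simp [laguerrePoly_zero]
    | succ n => simpa using X_mul_derivative_laguerrePoly_succ n
  simp only [C_add, C_mul, C_1, C_ofNat] at *
  linear_combination h2 - h1

lemma natDegree_laguerrePoly (n : ℕ) : (laguerrePoly n).natDegree = n := by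
  apply natDegree_eq_of_le_of_coeff_ne_zero
  · rw [natDegree_le_iff_coeff_eq_zero]
    intro k hk
    rw [coeff_laguerrePoly, Nat.choose_eq_zero_of_lt hk]; simp
  · rw [coeff_laguerrePoly]; simp [Nat.factorial_ne_zero]

/-- Integrate by parts with both polynomials and subtract: the boundary terms cancel because every
Laguerre polynomial equals 1 at 0. Each use lowers the degree of `q`, which gives orthogonality by
induction. -/
lemma gammaFunctional_laguerrePoly_succ_mul (n : ℕ) (q : ℝ[X]) :
    gammaFunctional (laguerrePoly (n + 1) * q) =
      gammaFunctional (laguerrePoly (n + 1) * derivative q) -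
        gammaFunctional (laguerrePoly n * derivative q) := by
  have h1 := gammaFunctional_derivative (laguerrePoly (n + 1) * q)
  have h2 := gammaFunctional_derivative (laguerrePoly n * q)
  rw [derivative_mul, map_add, mul_coeff_zero, coeff_laguerrePoly] at h1 h2
  rw [derivative_laguerrePoly_succ, sub_mul, map_sub] at h1
  simp at h1 h2
  linarith

lemma gammaFunctional_laguerrePoly_mul_eq_zero (d : ℕ) : ∀ (n : ℕ) (q : ℝ[X]),
    q.degree < d → d ≤ n → gammaFunctional (laguerrePoly n * q) = 0 := by
  induction d with
  | zero =>
    intro n q hq _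
    have : q = 0 := by simpa using hq
    simp [this]
  | succ d ih =>
    intro n q hq hn
    obtain ⟨n, rfl⟩ : ∃ m, n = m + 1 := ⟨n - 1, by omega⟩
    have hd : (derivative q).degree < d := by
      rw [degree_lt_iff_coeff_zero] at hq ⊢
      intro k hk
      rw [coeff_derivative, hq (k + 1) (by omega), zero_mul]
    rw [gammaFunctional_laguerrePoly_succ_mul, ih _ _ hd (by omega), ih _ _ hd (by omega), sub_zero]

lemma gammaFunctional_laguerrePoly_mul_of_lt {m n : ℕ} (h : m < n) :
    gammaFunctional (laguerrePoly n * laguerrePoly m) = 0 := by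
  refine gammaFunctional_laguerrePoly_mul_eq_zero n n _ ?_ le_rfl
  refine lt_of_le_of_lt degree_le_natDegree ?_
  rw [natDegree_laguerrePoly]
  exact_mod_cast h

lemma gammaFunctional_laguerrePoly_mul_derivative (n : ℕ) :
    gammaFunctional (laguerrePoly n * derivative (laguerrePoly n)) = 0 := by
  refine gammaFunctional_laguerrePoly_mul_eq_zero n n _ ?_ le_rfl
  rw [degree_lt_iff_coeff_zero]
  intro k hk
  rw [coeff_derivative, coeff_laguerrePoly, Nat.choose_eq_zero_of_lt (by omega)]
  simp

lemma gammaFunctional_laguerrePoly_mul_self (n : ℕ) :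
    gammaFunctional (laguerrePoly n * laguerrePoly n) = 1 := by
  induction n with
  | zero =>
    rw [laguerrePoly_zero, mul_one, ← monomial_zero_one, gammaFunctional_monomial]; simp
  | succ n ih =>
    rw [gammaFunctional_laguerrePoly_succ_mul, gammaFunctional_laguerrePoly_mul_derivative,
      derivative_laguerrePoly_succ, mul_sub, map_sub, gammaFunctional_laguerrePoly_mul_derivative,
      ih]
    norm_num

lemma gammaFunctional_laguerrePoly_mul (m n : ℕ) :
    gammaFunctional (laguerrePoly m * laguerrePoly n) = if m = n then 1 else 0 := by
  rcases lt_trichotomy m n with h | rfl | h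
  · rw [mul_comm, gammaFunctional_laguerrePoly_mul_of_lt h, if_neg h.ne]
  · rw [gammaFunctional_laguerrePoly_mul_self, if_pos rfl]
  · rw [gammaFunctional_laguerrePoly_mul_of_lt h, if_neg h.ne']

/-- The moment `∫ t ^ k ∑_{m < N} L_m(t)² e⁻ᵗ dt` of the one-point density of the unscaled
Laguerre ensemble. -/
def unscaledMoment (N k : ℕ) : ℝ :=
  ∑ m ∈ Finset.range N, gammaFunctional (X ^ k * laguerrePoly m ^ 2)

lemma X_mul_derivative_X_pow_mul (k : ℕ) (q : ℝ[X]) :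
    X * derivative (X ^ k * q) = C (k : ℝ) * (X ^ k * q) + X ^ k * (X * derivative q) := by
  rw [derivative_mul, derivative_X_pow]
  cases k with
  | zero => simp
  | succ k => simp only [add_tsub_cancel_right, pow_succ]; ring

/-- Integration by parts for the Euler operator t d/dt, which turns differential relations for
products of Laguerre polynomials into relations between moments. -/
lemma gammaFunctional_X_pow_mul_derivative (k : ℕ) (q : ℝ[X]) :
    gammaFunctional (X ^ k * (X * derivative q)) =
      gammaFunctional (X ^ (k + 1) * q) - (k + 1) * gammaFunctional (X ^ k * q) := by
  have h := gammaFunctional_X_mul_derivative (X ^ k * q)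
  rw [X_mul_derivative_X_pow_mul, map_add, gammaFunctional_C_mul, ← mul_assoc, ← mul_assoc,
    ← pow_succ'] at h
  rw [← mul_assoc]
  linarith

lemma X_mul_derivative_sq_succ (n : ℕ) :
    X * derivative (laguerrePoly (n + 1) ^ 2) = C (2 * ((n : ℝ) + 1)) *
      (laguerrePoly (n + 1) ^ 2 - laguerrePoly (n + 1) * laguerrePoly n) := by
  rw [pow_two, derivative_mul]
  have := X_mul_derivative_laguerrePoly_succ n
  rw [C_mul, C_ofNat]
  linear_combination 2 * laguerrePoly (n + 1) * this

/-- Weak form of (tρ)' = (n+1) L_{n+1} L_n e⁻ᵗ for the density ρ = ∑_{m≤n} L_m² e⁻ᵗ. Passing from n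
to n+1 adds (t L_{n+1}² e⁻ᵗ)', which the three-term recurrence identifies with the change of the
right-hand side. -/
lemma gammaFunctional_laguerrePoly_consecutive (n k : ℕ) :
    ((n : ℝ) + 1) * gammaFunctional (X ^ k * (laguerrePoly (n + 1) * laguerrePoly n)) =
      -k * unscaledMoment (n + 1) k := by
  induction n with
  | zero =>
    have h1 := gammaFunctional_X_pow_mul_derivative k 1
    have h2 := laguerrePoly_recurrence 0
    simp only [laguerrePoly_zero, CharP.cast_eq_zero, zero_add, C_1, one_mul, C_0, zero_mul,
      add_zero, mul_zero, mul_one] at h2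
    simp only [unscaledMoment, h2, laguerrePoly_zero, Finset.sum_range_one, zero_add, mul_one,
      one_pow, mul_sub, map_sub, CharP.cast_eq_zero, one_mul, ← pow_succ]
    simp only [derivative_one, mul_zero, map_zero, mul_one] at h1
    linarith
  | succ n ih =>
    rw [unscaledMoment, Finset.sum_range_succ, ← unscaledMoment, mul_add, ← ih]
    have h1 := gammaFunctional_X_pow_mul_derivative k (laguerrePoly (n + 1) ^ 2)
    rw [X_mul_derivative_sq_succ, mul_left_comm, gammaFunctional_C_mul, mul_sub, map_sub] at h1
    have h2 := congrArg (fun q => gammaFunctional (X ^ k * (q * laguerrePoly (n + 1))))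
      (laguerrePoly_recurrence (n + 1))
    simp only [add_tsub_cancel_right] at h2
    have e2 : X ^ k * ((C (((n + 1 : ℕ) : ℝ) + 1) * laguerrePoly (n + 1 + 1) +
        C (((n + 1 : ℕ) : ℝ)) * laguerrePoly n) * laguerrePoly (n + 1)) =
        C (((n + 1 : ℕ) : ℝ) + 1) * (X ^ k * (laguerrePoly (n + 1 + 1) * laguerrePoly (n + 1))) +
        C (((n + 1 : ℕ) : ℝ)) * (X ^ k * (laguerrePoly (n + 1) * laguerrePoly n)) := by ring
    have e3 : X ^ k * ((C (2 * ((n + 1 : ℕ) : ℝ) + 1) * laguerrePoly (n + 1) -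
        X * laguerrePoly (n + 1)) * laguerrePoly (n + 1)) =
        C (2 * ((n + 1 : ℕ) : ℝ) + 1) * (X ^ k * laguerrePoly (n + 1) ^ 2) -
        X ^ (k + 1) * laguerrePoly (n + 1) ^ 2 := by ring
    rw [e2, e3, map_add, map_sub, gammaFunctional_C_mul, gammaFunctional_C_mul,
      gammaFunctional_C_mul] at h2
    push_cast at h2 ⊢
    linarith

lemma unscaledMoment_zero_right (N : ℕ) : unscaledMoment N 0 = N := by
  simp [unscaledMoment, pow_two, gammaFunctional_laguerrePoly_mul_self]

lemma X_mul_derivative_laguerrePoly (n : ℕ) :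
    X * derivative (laguerrePoly n) =
      C ((n : ℝ) + 1) * (laguerrePoly (n + 1) - laguerrePoly n) + X * laguerrePoly n := by
  rw [← X_mul_derivative_laguerrePoly_succ, derivative_laguerrePoly_succ]
  ring

/-- The recursion of Haagerup and Thorbjørnsen for the moments of the Laguerre ensemble. -/
lemma unscaledMoment_recurrence (N k : ℕ) :
    ((k : ℝ) + 3) * unscaledMoment N (k + 2) =
      2 * N * (2 * k + 3) * unscaledMoment N (k + 1) +
        ((k : ℝ) + 1) ^ 2 * k * unscaledMoment N k := by
  cases N with
  | zero => simp [unscaledMoment]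
  | succ n =>
  set U : ℕ → ℝ := fun k => gammaFunctional (X ^ k * laguerrePoly (n + 1) ^ 2) with hU
  set V : ℕ → ℝ := fun k => gammaFunctional (X ^ k * laguerrePoly n ^ 2) with hV
  set P : ℕ → ℝ := fun k => gammaFunctional (X ^ k * (laguerrePoly (n + 1) * laguerrePoly n))
    with hP
  have hu : ∀ k : ℕ, 2 * ((n : ℝ) + 1) * (U k - P k) = U (k + 1) - (k + 1) * U k := by
    intro k
    have h := gammaFunctional_X_pow_mul_derivative k (laguerrePoly (n + 1) ^ 2)
    rw [X_mul_derivative_sq_succ, mul_left_comm, gammaFunctional_C_mul, mul_sub, map_sub] at h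
    exact h
  have hv : ∀ k : ℕ, 2 * ((n : ℝ) + 1) * (P k - V k) + 2 * V (k + 1) =
      V (k + 1) - (k + 1) * V k := by
    intro k
    have h := gammaFunctional_X_pow_mul_derivative k (laguerrePoly n ^ 2)
    have e : X ^ k * (X * derivative (laguerrePoly n ^ 2)) = C (2 * ((n : ℝ) + 1)) *
        (X ^ k * (laguerrePoly (n + 1) * laguerrePoly n) - X ^ k * laguerrePoly n ^ 2) +
        C 2 * (X ^ (k + 1) * laguerrePoly n ^ 2) := by
      rw [pow_two, derivative_mul, C_mul, C_ofNat]
      linear_combination 2 * X ^ k * laguerrePoly n * X_mul_derivative_laguerrePoly n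
    rw [e, map_add, gammaFunctional_C_mul, gammaFunctional_C_mul, map_sub] at h
    exact h
  have hp : ∀ k : ℕ, ((n : ℝ) + 1) * (U k - V k) + P (k + 1) = P (k + 1) - (k + 1) * P k := by
    intro k
    have h := gammaFunctional_X_pow_mul_derivative k (laguerrePoly (n + 1) * laguerrePoly n)
    have e : X ^ k * (X * derivative (laguerrePoly (n + 1) * laguerrePoly n)) = C ((n : ℝ) + 1) *
        (X ^ k * laguerrePoly (n + 1) ^ 2 - X ^ k * laguerrePoly n ^ 2) +
        X ^ (k + 1) * (laguerrePoly (n + 1) * laguerrePoly n) := by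
      rw [derivative_mul]
      linear_combination X ^ k * laguerrePoly (n + 1) * X_mul_derivative_laguerrePoly n +
        X ^ k * laguerrePoly n * X_mul_derivative_laguerrePoly_succ n
    rw [e, map_add, gammaFunctional_C_mul, map_sub] at h
    exact h
  have hM : ∀ k : ℕ, ((n : ℝ) + 1) * P k = -k * unscaledMoment (n + 1) k :=
    gammaFunctional_laguerrePoly_consecutive n
  have u0 := hu k
  have v0 := hv k
  have p0 := hp k
  have p1 := hp (k + 1)
  have u1 := hu (k + 1)
  have v1 := hv (k + 1)
  have p2 := hp (k + 2)
  have m0 := hM k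
  have m1 := hM (k + 1)
  have m2 := hM (k + 2)
  have hn : (n : ℝ) + 1 ≠ 0 := by positivity
  push_cast at *
  set a : ℝ := (n : ℝ) + 1
  set κ : ℝ := (k : ℝ)
  have hκ1 : κ + 1 ≠ 0 := by positivity
  have hκ2 : κ + 2 ≠ 0 := by positivity
  -- Elimination: `hp` expresses U − V through P, the sum of `hu` and `hv` expresses U + V through
  -- differences U − V, and their difference is `key`. What remains relates P at k, k+1, k+2, and
  -- `hM` turns P into moments.
  have d0 : U k - V k = -(κ + 1) * P k / a := by field_simp; linarith
  have d1 : U (k + 1) - V (k + 1) = -(κ + 2) * P (k + 1) / a := by field_simp; linarith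
  have d2 : U (k + 2) - V (k + 2) = -(κ + 3) * P (k + 2) / a := by field_simp; linarith
  have s0 : U k + V k = ((U (k + 1) - V (k + 1)) - 2 * a * (U k - V k)) / (κ + 1) := by
    field_simp; linarith
  have s1 : U (k + 1) + V (k + 1) =
      ((U (k + 2) - V (k + 2)) - 2 * a * (U (k + 1) - V (k + 1))) / (κ + 2) := by
    field_simp; linarith
  have key : 2 * a * (U k + V k) - 4 * a * P k - (U (k + 1) + V (k + 1)) =
      -(κ + 1) * (U k - V k) := by linarith
  rw [s0, s1, d0, d1, d2] at key
  have q0 : P k = -κ * unscaledMoment (n + 1) k / a := by field_simp; linarith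
  have q1 : P (k + 1) = -(κ + 1) * unscaledMoment (n + 1) (k + 1) / a := by field_simp; linarith
  have q2 : P (k + 2) = -(κ + 2) * unscaledMoment (n + 1) (k + 2) / a := by field_simp; linarith
  rw [q0, q1, q2] at key
  field_simp at key
  linear_combination -key

lemma unscaledMoment_one_right (N : ℕ) : unscaledMoment N 1 = (N : ℝ) ^ 2 := by
  rw [unscaledMoment]
  have h : ∀ m : ℕ, gammaFunctional (X ^ 1 * laguerrePoly m ^ 2) = 2 * m + 1 := by
    intro m
    have h := congrArg (fun q => gammaFunctional (q * laguerrePoly m)) (laguerrePoly_recurrence m)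
    simp only [add_mul, sub_mul, map_add, map_sub, mul_assoc, gammaFunctional_C_mul,
      gammaFunctional_laguerrePoly_mul] at h
    rw [pow_one, pow_two]
    -- For m = 0 the index `m - 1` coincides with `m`, so the orthogonality test evaluates
    -- differently.
    cases m <;> simp at h <;> push_cast <;> linarith
  simp only [h]
  induction N with
  | zero => simp
  | succ n ih => rw [Finset.sum_range_succ, ih]; push_cast; ring

end LaguerrePolynomials

/-! ### Reduction of the N-fold integral to the one-point density -/

section OnePointDensity

open Polynomial MeasureTheory

section Determinantal

variable {N : ℕ} {μ : Measure ℝ} [SigmaFinite μ] {ψ : Fin N → ℝ → ℂ}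

lemma det_sq_mul_prod (g : Fin N → ℝ → ℂ) (l : Fin N → ℝ) :
    (Matrix.of fun a b => ψ a (l b)).det ^ 2 * ∏ j, g j (l j) =
      ∑ σ : Equiv.Perm (Fin N), ∑ τ : Equiv.Perm (Fin N),
        (((Equiv.Perm.sign σ : ℤ) : ℂ) * ((Equiv.Perm.sign τ : ℤ) : ℂ)) *
          ∏ j, (g j (l j) * (ψ (σ j) (l j) * ψ (τ j) (l j))) := by
  rw [Matrix.det_apply', pow_two, Finset.sum_mul_sum, Finset.sum_mul]
  refine Finset.sum_congr rfl fun σ _ => ?_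
  rw [Finset.sum_mul]
  refine Finset.sum_congr rfl fun τ _ => ?_
  simp only [Matrix.of_apply, Finset.prod_mul_distrib]
  ring

lemma integrable_det_sq_mul_prod (g : Fin N → ℝ → ℂ)
    (hg : ∀ j a b, Integrable (fun t => g j t * (ψ a t * ψ b t)) μ) :
    Integrable (fun l : Fin N → ℝ => (Matrix.of fun a b => ψ a (l b)).det ^ 2 * ∏ j, g j (l j))
      (Measure.pi fun _ => μ) := by
  simp only [det_sq_mul_prod]
  refine integrable_finsetSum _ fun σ _ => integrable_finsetSum _ fun τ _ => ?_
  exact (Integrable.fintype_prod fun j => hg j (σ j) (τ j)).const_mul _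

/-- The identity of Andréief, with a separate test function for each variable. -/
lemma integral_det_sq_mul_prod (g : Fin N → ℝ → ℂ)
    (hg : ∀ j a b, Integrable (fun t => g j t * (ψ a t * ψ b t)) μ) :
    ∫ l : Fin N → ℝ, (Matrix.of fun a b => ψ a (l b)).det ^ 2 * ∏ j, g j (l j)
        ∂(Measure.pi fun _ => μ) =
      ∑ σ : Equiv.Perm (Fin N), ∑ τ : Equiv.Perm (Fin N),
        (((Equiv.Perm.sign σ : ℤ) : ℂ) * ((Equiv.Perm.sign τ : ℤ) : ℂ)) *
          ∏ j, ∫ t, g j t * (ψ (σ j) t * ψ (τ j) t) ∂μ := by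
  have hi : ∀ σ τ : Equiv.Perm (Fin N), Integrable (fun l : Fin N → ℝ =>
      (((Equiv.Perm.sign σ : ℤ) : ℂ) * ((Equiv.Perm.sign τ : ℤ) : ℂ)) *
          ∏ j, (g j (l j) * (ψ (σ j) (l j) * ψ (τ j) (l j)))) (Measure.pi fun _ => μ) :=
    fun σ τ => (Integrable.fintype_prod fun j => hg j (σ j) (τ j)).const_mul _
  simp only [det_sq_mul_prod]
  rw [integral_finsetSum _ fun σ _ => integrable_finsetSum _ fun τ _ => hi σ τ]
  refine Finset.sum_congr rfl fun σ _ => ?_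
  rw [integral_finsetSum _ fun τ _ => hi σ τ]
  refine Finset.sum_congr rfl fun τ _ => ?_
  rw [integral_const_mul]
  congr 1
  exact integral_fintype_prod_eq_prod (fun j t => g j t * (ψ (σ j) t * ψ (τ j) t))

lemma sign_mul_self_cast (σ : Equiv.Perm (Fin N)) :
    ((Equiv.Perm.sign σ : ℤ) : ℂ) * ((Equiv.Perm.sign σ : ℤ) : ℂ) = 1 := by
  rw [← Int.cast_mul, Int.units_coe_mul_self, Int.cast_one]

/-- Orthonormality leaves only the diagonal terms σ = τ, each equal to 1. -/
lemma integral_det_sq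
    (hψ : ∀ a b, Integrable (fun t => ψ a t * ψ b t) μ)
    (hδ : ∀ a b, ∫ t, ψ a t * ψ b t ∂μ = if a = b then 1 else 0) :
    ∫ l : Fin N → ℝ, (Matrix.of fun a b => ψ a (l b)).det ^ 2 ∂(Measure.pi fun _ => μ) = N ! := by
  have h := integral_det_sq_mul_prod (μ := μ) (ψ := ψ) (fun _ _ => 1)
    (by simpa using fun _ => hψ)
  simp only [Finset.prod_const_one, mul_one, one_mul, hδ] at h
  rw [h]
  have : ∀ σ : Equiv.Perm (Fin N), ∑ τ : Equiv.Perm (Fin N),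
      (((Equiv.Perm.sign σ : ℤ) : ℂ) * ((Equiv.Perm.sign τ : ℤ) : ℂ)) *
          ∏ j, (if σ j = τ j then (1 : ℂ) else 0) = 1 := by
    intro σ
    rw [Finset.sum_eq_single σ]
    · simp [sign_mul_self_cast]
    · intro τ _ hτ
      obtain ⟨j, hj⟩ : ∃ j, σ j ≠ τ j := by
        by_contra! hc
        exact hτ (Equiv.ext fun j => (hc j).symm)
      rw [Finset.prod_eq_zero (Finset.mem_univ j) (if_neg hj), mul_zero]
    · simp
  simp [this, Fintype.card_perm]

/-- When the test function sits at the variable `i`, orthogonality constrains σ and τ only off `i`;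
this still forces σ = τ. -/
lemma perm_eq_of_eq_off {σ τ : Equiv.Perm (Fin N)} (i : Fin N) (h : ∀ j ≠ i, σ j = τ j) :
    σ = τ := by
  ext1 j
  by_cases hj : j = i
  · subst hj
    by_contra hne
    obtain ⟨m, hm⟩ := σ.surjective (τ j)
    have hmj : m ≠ j := by rintro rfl; exact hne hm
    exact hmj (τ.injective ((h m hmj).symm.trans hm))
  · exact h j hj

/-- The mean of a linear statistic in a determinantal ensemble built from orthonormal functions. -/
lemma integral_det_sq_mul_sum
    (hψ : ∀ a b, Integrable (fun t => ψ a t * ψ b t) μ)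
    (hδ : ∀ a b, ∫ t, ψ a t * ψ b t ∂μ = if a = b then 1 else 0) (f : ℝ → ℂ)
    (hf : ∀ a b, Integrable (fun t => f t * (ψ a t * ψ b t)) μ) :
    ∫ l : Fin N → ℝ, (Matrix.of fun a b => ψ a (l b)).det ^ 2 * ∑ i, f (l i)
        ∂(Measure.pi fun _ => μ) = N ! * ∑ a, ∫ t, f t * (ψ a t * ψ a t) ∂μ := by
  have hu : ∀ i j a b, Integrable
      (fun t => Function.update (fun (_ : Fin N) (_ : ℝ) => (1 : ℂ)) i f j t * (ψ a t * ψ b t)) μ := by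
    intro i j a b
    by_cases hj : j = i
    · subst hj; simpa using hf a b
    · simpa [Function.update_of_ne hj] using hψ a b
  -- A function of one variable is a product with trivial factors elsewhere, so Andréief's identity
  -- applies.
  have hp : ∀ (i : Fin N) (l : Fin N → ℝ),
      f (l i) = ∏ j, Function.update (fun (_ : Fin N) (_ : ℝ) => (1 : ℂ)) i f j (l j) := by
    intro i l
    rw [Finset.prod_eq_single i]
    · simp
    · intro j _ hj; simp [Function.update_of_ne hj]
    · simp
  simp only [Finset.mul_sum]
  rw [integral_finsetSum]
  swap
  · intro i _
    simp only [hp i]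
    exact integrable_det_sq_mul_prod _ (hu i)
  have key : ∀ i : Fin N, ∫ l : Fin N → ℝ, (Matrix.of fun a b => ψ a (l b)).det ^ 2 * f (l i)
      ∂(Measure.pi fun _ => μ) =
      ∑ σ : Equiv.Perm (Fin N), ∫ t, f t * (ψ (σ i) t * ψ (σ i) t) ∂μ := by
    intro i
    simp only [hp i]
    rw [integral_det_sq_mul_prod _ (hu i)]
    refine Finset.sum_congr rfl fun σ _ => ?_
    rw [Finset.sum_eq_single σ]
    · rw [sign_mul_self_cast, one_mul, Finset.prod_eq_single i]
      · simp
      · intro j _ hj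
        simp [Function.update_of_ne hj, hδ]
      · simp
    · intro τ _ hτ
      obtain ⟨j, hj, hne⟩ : ∃ j, j ≠ i ∧ σ j ≠ τ j := by
        by_contra! hc
        exact hτ (perm_eq_of_eq_off i hc).symm
      rw [Finset.prod_eq_zero (Finset.mem_univ j), mul_zero]
      simp [Function.update_of_ne hj, hδ, hne]
    · simp
  simp only [key]
  rw [Finset.sum_comm]
  simp only [fun σ : Equiv.Perm (Fin N) =>
    Equiv.sum_comp σ fun a => ∫ t, f t * (ψ a t * ψ a t) ∂μ]
  simp [Fintype.card_perm, Finset.mul_sum]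

end Determinantal

lemma integrableOn_pow_mul_exp_neg (n : ℕ) :
    IntegrableOn (fun t : ℝ => t ^ n * Real.exp (-t)) (Set.Ioi 0) := by
  have h := Real.GammaIntegral_convergent (s := n + 1) (by positivity)
  simpa [mul_comm] using h

lemma integrableOn_eval_mul_exp_neg (q : ℝ[X]) :
    IntegrableOn (fun t : ℝ => q.eval t * Real.exp (-t)) (Set.Ioi 0) := by
  simp only [eval_eq_sum_range, Finset.sum_mul, mul_assoc]
  exact integrable_finsetSum _ fun n _ => (integrableOn_pow_mul_exp_neg n).const_mul _

lemma integral_eval_mul_exp_neg (q : ℝ[X]) :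
    ∫ t in Set.Ioi (0 : ℝ), q.eval t * Real.exp (-t) = gammaFunctional q := by
  induction q using Polynomial.induction_on' with
  | add p q hp hq =>
    simp only [eval_add, add_mul, map_add]
    rw [integral_add (integrableOn_eval_mul_exp_neg p) (integrableOn_eval_mul_exp_neg q), hp, hq]
  | monomial n a =>
    simp only [eval_monomial, mul_assoc]
    rw [integral_const_mul, gammaFunctional_monomial, ← Real.Gamma_nat_eq_factorial,
      Real.Gamma_eq_integral (by positivity), mul_comm a]
    congr 1
    simp [mul_comm]

lemma integrableOn_eval_scaled (q : ℝ[X]) {c : ℝ} (hc : 0 < c) :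
    IntegrableOn (fun t : ℝ => q.eval (c * t) * Real.exp (-(c * t))) (Set.Ici 0) := by
  rw [integrableOn_Ici_iff_integrableOn_Ioi]
  have h := (integrableOn_Ioi_comp_mul_left_iff
    (fun t : ℝ => q.eval t * Real.exp (-t)) 0 hc).2 (by simpa using integrableOn_eval_mul_exp_neg q)
  exact h

lemma integral_eval_scaled (q : ℝ[X]) {c : ℝ} (hc : 0 < c) :
    ∫ t in Set.Ici (0 : ℝ), q.eval (c * t) * Real.exp (-(c * t)) = c⁻¹ * gammaFunctional q := by
  rw [integral_Ici_eq_integral_Ioi,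
    integral_comp_mul_left_Ioi (fun t : ℝ => q.eval t * Real.exp (-t)) 0 hc, mul_zero,
    integral_eval_mul_exp_neg, smul_eq_mul]

/-- The orthonormal functions of the Laguerre ensemble of size `N`. -/
def laguerreFun (N m : ℕ) (t : ℝ) : ℝ :=
  √N * (laguerrePoly m).eval (N * t) * Real.exp (-(N * t) / 2)

lemma laguerreFun_mul (N m n : ℕ) (t : ℝ) :
    laguerreFun N m t * laguerreFun N n t =
      N * ((laguerrePoly m * laguerrePoly n).eval (N * t) * Real.exp (-(N * t))) := by
  have h1 : √(N : ℝ) * √N = N := Real.mul_self_sqrt (by positivity)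
  have h2 : Real.exp (-(N * t) / 2) * Real.exp (-(N * t) / 2) = Real.exp (-(N * t)) := by
    rw [← Real.exp_add]; ring_nf
  rw [laguerreFun, laguerreFun, eval_mul, ← h2]
  linear_combination (eval (N * t) (laguerrePoly m) * Real.exp (-(N * t) / 2) *
    (eval (N * t) (laguerrePoly n) * Real.exp (-(N * t) / 2))) * h1

/-- The normalised one-point density of the Laguerre ensemble, of total mass `N`. -/
def density (N : ℕ) (t : ℝ) : ℝ :=
  ∑ m ∈ Finset.range N, laguerreFun N m t * laguerreFun N m t

/-- Column operations turn the Vandermonde determinant into one in any monic polynomials of degrees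
0, …, N−1. The constant κ need not be known, as it cancels against the partition function. -/
lemma weight_eq_det_sq (N : ℕ) (hN : 0 < N) : ∃ κ : ℝ, κ ≠ 0 ∧ ∀ l : Fin N → ℝ,
    weight N l = κ * (Matrix.of fun a b : Fin N => laguerreFun N a (l b)).det ^ 2 := by
  have hN' : (N : ℝ) ≠ 0 := by positivity
  -- The leading coefficient of L_j(Nt).
  set b : Fin N → ℝ := fun j => (-1) ^ (j : ℕ) / (j : ℕ)! * (N : ℝ) ^ (j : ℕ) with hb
  have hb0 : ∀ j, b j ≠ 0 := by
    intro j
    have : ((j : ℕ)! : ℝ) ≠ 0 := by positivity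
    simp only [hb]
    positivity
  set q : Fin N → ℝ[X] := fun j => C (b j)⁻¹ * (laguerrePoly j).comp (C (N : ℝ) * X) with hq
  have hdegX : (C (N : ℝ) * X).natDegree = 1 := natDegree_C_mul_X _ hN'
  have hdeg : ∀ j, (q j).natDegree = j := by
    intro j
    simp only [hq]
    rw [natDegree_C_mul (inv_ne_zero (hb0 j)), natDegree_comp, hdegX, natDegree_laguerrePoly,
      mul_one]
  have hmonic : ∀ j, (q j).Monic := by
    intro j
    simp only [hq, Monic]
    rw [leadingCoeff_mul, leadingCoeff_C, leadingCoeff_comp (by rw [hdegX]; norm_num),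
      leadingCoeff_C_mul_X, natDegree_laguerrePoly, leadingCoeff, natDegree_laguerrePoly,
      coeff_laguerrePoly, Nat.choose_self, Nat.cast_one, mul_one]
    exact inv_mul_cancel₀ (hb0 j)
  have hψ : ∀ (j : Fin N) (t : ℝ),
      laguerreFun N j t = (√N * b j) * (Real.exp (-(N * t) / 2) * (q j).eval t) := by
    intro j t
    simp only [laguerreFun, hq, eval_mul, eval_C, eval_comp, eval_X]
    field_simp [hb0 j]
  have hdet : ∀ l : Fin N → ℝ, (Matrix.of fun a b : Fin N => laguerreFun N a (l b)).det =
      (∏ j, (√N * b j)) * ((∏ i, Real.exp (-(N * l i) / 2)) *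
        ∏ i, ∏ j ∈ Finset.Ioi i, (l j - l i)) := by
    intro l
    rw [← Matrix.det_vandermonde, Matrix.det_eval_matrixOfPolynomials_eq_det_vandermonde l q hdeg
      hmonic, ← Matrix.det_mul_column, ← Matrix.det_mul_row, ← Matrix.det_transpose]
    congr 1
    ext i j
    simp only [Matrix.transpose_apply, Matrix.of_apply]
    exact hψ j (l i)
  have hne : ∏ j, (√N * b j) ≠ 0 := by
    refine Finset.prod_ne_zero_iff.2 fun j _ => mul_ne_zero ?_ (hb0 j)
    positivity
  refine ⟨((∏ j, (√N * b j)) ^ 2)⁻¹, inv_ne_zero (pow_ne_zero 2 hne), fun l => ?_⟩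
  rw [hdet, mul_pow, inv_mul_cancel_left₀ (pow_ne_zero 2 hne), mul_pow, weight]
  congr 1
  · rw [← Real.exp_sum, ← Real.exp_nat_mul, ← Finset.sum_div, Finset.sum_neg_distrib,
      ← Finset.mul_sum]
    congr 1
    push_cast
    ring
  · simp only [← Finset.prod_pow]
    exact Finset.prod_congr rfl fun i _ => Finset.prod_congr rfl fun j _ => sub_sq_comm _ _

lemma restrict_domain (N : ℕ) : (volume : Measure (Fin N → ℝ)).restrict (domain N) =
    Measure.pi fun _ => (volume : Measure ℝ).restrict (Set.Ici 0) := by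
  rw [← Measure.restrict_pi_pi, ← volume_pi]
  congr 1
  ext l
  simp only [domain, Set.mem_ofPred_eq, Set.mem_univ_pi, Set.mem_Ici]

lemma integrableOn_laguerreFun_mul {N : ℕ} (hN : 0 < N) (m n : ℕ) :
    IntegrableOn (fun t => laguerreFun N m t * laguerreFun N n t) (Set.Ici 0) := by
  simp only [laguerreFun_mul]
  exact (integrableOn_eval_scaled _ (by positivity)).const_mul _

lemma integral_laguerreFun_mul {N : ℕ} (hN : 0 < N) (m n : ℕ) :
    ∫ t in Set.Ici 0, laguerreFun N m t * laguerreFun N n t = if m = n then 1 else 0 := by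
  simp only [laguerreFun_mul]
  have hN' : (0 : ℝ) < N := by positivity
  rw [integral_const_mul, integral_eval_scaled _ hN', gammaFunctional_laguerrePoly_mul,
    mul_inv_cancel_left₀ hN'.ne']

/-- The distance `δ` to the half-line bounds the resolvent, hence gives integrability; κ and N!
cancel in the quotient. -/
lemma oneLoopMean_eq_integral_density {N : ℕ} (hN : 0 < N) {x : ℂ} {δ : ℝ} (hδ : 0 < δ)
    (hx : ∀ t : ℝ, 0 ≤ t → δ ≤ ‖x - t‖) :
    oneLoopMean N x = ∫ t in Set.Ici (0 : ℝ), (x - t)⁻¹ * (density N t : ℂ) := by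
  obtain ⟨κ, hκ, hw⟩ := weight_eq_det_sq N hN
  set ψ : Fin N → ℝ → ℂ := fun a t => ((laguerreFun N a t : ℝ) : ℂ) with hψ
  have hwc : ∀ l, ((weight N l : ℝ) : ℂ) =
      κ * (Matrix.of fun a b => ψ a (l b)).det ^ 2 := by
    intro l
    rw [hw, Complex.ofReal_mul, Complex.ofReal_pow]
    congr 2
    have := RingHom.map_det Complex.ofRealHom (Matrix.of fun a b : Fin N => laguerreFun N a (l b))
    rw [Complex.ofRealHom_eq_coe] at this
    rw [this]
    rfl
  have hi : ∀ a b, Integrable (fun t => ψ a t * ψ b t) (volume.restrict (Set.Ici 0)) := by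
    intro a b
    have := (integrableOn_laguerreFun_mul hN a b).ofReal (𝕜 := ℂ)
    simpa [hψ] using this
  have ho : ∀ a b, ∫ t, ψ a t * ψ b t ∂(volume.restrict (Set.Ici 0)) =
      if a = b then 1 else 0 := by
    intro a b
    simp only [hψ, ← Complex.ofReal_mul]
    rw [integral_complex_ofReal, integral_laguerreFun_mul hN]
    split_ifs with h1 h2 h2 <;> simp_all [Fin.ext_iff]
  have hf : ∀ a b, Integrable (fun t : ℝ => (x - t)⁻¹ * (ψ a t * ψ b t))
      (volume.restrict (Set.Ici 0)) := by
    intro a b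
    refine (hi a b).bdd_mul (c := δ⁻¹) (by measurability) ?_
    refine (ae_restrict_iff' measurableSet_Ici).2 (Filter.Eventually.of_forall fun t ht => ?_)
    rw [norm_inv]
    exact inv_anti₀ hδ (hx t ht)
  have hZ : ((partitionFunction N : ℝ) : ℂ) = κ * N ! := by
    rw [partitionFunction, ← integral_complex_ofReal, restrict_domain]
    simp only [hwc]
    rw [integral_const_mul, integral_det_sq hi ho]
  rw [oneLoopMean, hZ, restrict_domain]
  simp only [hwc, mul_assoc]
  rw [integral_const_mul, integral_det_sq_mul_sum hi ho (fun t : ℝ => (x - t)⁻¹) hf]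
  have h1 : (κ : ℂ) ≠ 0 := by exact_mod_cast hκ
  have h2 : (N ! : ℂ) ≠ 0 := by exact_mod_cast Nat.factorial_ne_zero N
  rw [← integral_finsetSum _ fun a _ => hf a a]
  rw [← mul_assoc (κ : ℂ), inv_mul_cancel_left₀ (mul_ne_zero h1 h2)]
  congr 1
  ext t
  rw [← Finset.mul_sum]
  congr 1
  simp only [density, hψ, Complex.ofReal_sum, Complex.ofReal_mul, Finset.sum_range]

end OnePointDensity

/-! ### Moments of the density and truncation of the Stieltjes transform -/

section Moments

open Polynomial MeasureTheory

/-- The `k`-th moment of the one-point density of the Laguerre ensemble, divided by `N`. -/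
def normalizedMoment (N k : ℕ) : ℝ :=
  unscaledMoment N k / (N : ℝ) ^ (k + 1)

lemma density_nonneg (N : ℕ) (t : ℝ) : 0 ≤ density N t :=
  Finset.sum_nonneg fun _ _ => mul_self_nonneg _

lemma pow_mul_density (N k : ℕ) (hN : 0 < N) (t : ℝ) :
    t ^ k * density N t = ∑ m ∈ Finset.range N, ((N : ℝ) / N ^ k) *
      ((X ^ k * laguerrePoly m ^ 2).eval (N * t) * Real.exp (-(N * t))) := by
  have : (N : ℝ) ≠ 0 := by positivity
  rw [density, Finset.mul_sum]
  refine Finset.sum_congr rfl fun m _ => ?_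
  rw [laguerreFun_mul]
  simp only [eval_mul, eval_pow, eval_X]
  field_simp
  ring

lemma integrableOn_pow_mul_density {N : ℕ} (hN : 0 < N) (k : ℕ) :
    IntegrableOn (fun t => t ^ k * density N t) (Set.Ici 0) := by
  simp only [pow_mul_density N k hN]
  exact integrable_finsetSum _ fun m _ =>
    (integrableOn_eval_scaled _ (by positivity)).const_mul _

lemma integral_pow_mul_density {N : ℕ} (hN : 0 < N) (k : ℕ) :
    ∫ t in Set.Ici 0, t ^ k * density N t = N * normalizedMoment N k := by
  have hN' : (0 : ℝ) < N := by positivity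
  simp only [pow_mul_density N k hN]
  rw [integral_finsetSum _ fun m _ => (integrableOn_eval_scaled _ hN').const_mul _]
  simp only [integral_const_mul, integral_eval_scaled _ hN']
  rw [← Finset.mul_sum, ← Finset.mul_sum, ← unscaledMoment, normalizedMoment, pow_succ]
  field_simp

lemma normalizedMoment_zero_right {N : ℕ} (hN : 0 < N) : normalizedMoment N 0 = 1 := by
  have : (N : ℝ) ≠ 0 := by positivity
  rw [normalizedMoment, unscaledMoment_zero_right]
  simp [this]

lemma normalizedMoment_one_right {N : ℕ} (hN : 0 < N) : normalizedMoment N 1 = 1 := by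
  have : (N : ℝ) ≠ 0 := by positivity
  rw [normalizedMoment, unscaledMoment_one_right]
  simp [this]

lemma normalizedMoment_recurrence {N : ℕ} (hN : 0 < N) (k : ℕ) :
    ((k : ℝ) + 3) * normalizedMoment N (k + 2) =
      2 * (2 * k + 3) * normalizedMoment N (k + 1) +
        ((N : ℝ) ^ 2)⁻¹ * (((k : ℝ) + 1) ^ 2 * k * normalizedMoment N k) := by
  have : (N : ℝ) ≠ 0 := by positivity
  have h := unscaledMoment_recurrence N k
  simp only [normalizedMoment, pow_succ]
  field_simp
  linear_combination h

lemma inv_sub_sub_sum_geometric {x t : ℂ} (hx : x ≠ 0) (hxt : x - t ≠ 0) (K : ℕ) :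
    (x - t)⁻¹ - ∑ k ∈ Finset.range K, t ^ k * (x ^ (k + 1))⁻¹ =
      (x ^ K)⁻¹ * ((x - t)⁻¹ * t ^ K) := by
  induction K with
  | zero => simp
  | succ K ih =>
    rw [Finset.sum_range_succ, ← sub_sub, ih]
    field_simp
    ring

lemma exists_dist_pos_of_mem_cutNhd {R : ℝ} {x : ℂ} (hx : x ∈ cutNhd R) :
    ∃ δ : ℝ, 0 < δ ∧ ∀ t : ℝ, 0 ≤ t → δ ≤ ‖x - t‖ := by
  have hc : IsClosed ((fun t : ℝ => (t : ℂ)) '' Set.Ici 0) :=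
    Complex.isometry_ofReal.isClosedEmbedding.isClosedMap _ isClosed_Ici
  have hn : x ∉ (fun t : ℝ => (t : ℂ)) '' Set.Ici 0 := by
    rintro ⟨t, ht, rfl⟩
    exact hx.2 t ht rfl
  refine ⟨_, (hc.notMem_iff_infDist_pos ⟨_, 0, Set.mem_Ici.2 le_rfl, rfl⟩).1 hn, fun t ht => ?_⟩
  rw [← dist_eq_norm]
  exact Metric.infDist_le_dist_of_mem ⟨t, ht, rfl⟩

/-- Truncating the moment expansion of the one-loop mean. -/
lemma norm_oneLoopMean_sub_sum_le {N : ℕ} (hN : 0 < N) {x : ℂ} {δ : ℝ} (hδ : 0 < δ)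
    (hx : ∀ t : ℝ, 0 ≤ t → δ ≤ ‖x - t‖) (K : ℕ) :
    ‖oneLoopMean N x - N * ∑ k ∈ Finset.range K, (normalizedMoment N k : ℂ) * (x ^ (k + 1))⁻¹‖ ≤
      (‖x‖ ^ K)⁻¹ * (δ⁻¹ * (N * normalizedMoment N K)) := by
  have hx0 : x ≠ 0 := by
    have := hx 0 le_rfl
    rw [← norm_pos_iff]
    simpa using hδ.trans_le this
  have hi : ∀ k : ℕ, Integrable (fun t : ℝ => ((t ^ k * density N t : ℝ) : ℂ))
      (volume.restrict (Set.Ici 0)) := fun k => (integrableOn_pow_mul_density hN k).ofReal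
  have hb : ∀ᵐ t : ℝ ∂(volume.restrict (Set.Ici 0)), ‖(x - t)⁻¹‖ ≤ δ⁻¹ := by
    refine (ae_restrict_iff' measurableSet_Ici).2 (Filter.Eventually.of_forall fun t ht => ?_)
    rw [norm_inv]
    exact inv_anti₀ hδ (hx t ht)
  have hsum : N * ∑ k ∈ Finset.range K, (normalizedMoment N k : ℂ) * (x ^ (k + 1))⁻¹ =
      ∫ t in Set.Ici (0 : ℝ), ∑ k ∈ Finset.range K,
        ((t ^ k * density N t : ℝ) : ℂ) * (x ^ (k + 1))⁻¹ := by
    rw [integral_finsetSum _ fun k _ => (hi k).mul_const _, Finset.mul_sum]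
    refine Finset.sum_congr rfl fun k _ => ?_
    rw [integral_mul_const, integral_complex_ofReal, integral_pow_mul_density hN]
    push_cast
    ring
  have hi0 : Integrable (fun t : ℝ => (x - t)⁻¹ * (density N t : ℂ))
      (volume.restrict (Set.Ici 0)) := by
    refine Integrable.bdd_mul (by simpa using hi 0) (by measurability) hb
  rw [oneLoopMean_eq_integral_density hN hδ hx, hsum,
    ← integral_sub hi0 (integrable_finsetSum _ fun k _ => (hi k).mul_const _)]
  have hcongr : ∫ t in Set.Ici (0 : ℝ), ((x - t)⁻¹ * (density N t : ℂ) -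
      ∑ k ∈ Finset.range K, ((t ^ k * density N t : ℝ) : ℂ) * (x ^ (k + 1))⁻¹) =
      ∫ t in Set.Ici (0 : ℝ), (x ^ K)⁻¹ * ((x - t)⁻¹ * ((t ^ K * density N t : ℝ) : ℂ)) := by
    refine setIntegral_congr_fun measurableSet_Ici fun t ht => ?_
    have hxt : x - t ≠ 0 := norm_pos_iff.1 (hδ.trans_le (hx t ht))
    have h := inv_sub_sub_sum_geometric hx0 hxt K
    simp only [Complex.ofReal_mul, Complex.ofReal_pow]
    calc _ = ((x - t)⁻¹ - ∑ k ∈ Finset.range K, (t : ℂ) ^ k * (x ^ (k + 1))⁻¹) *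
          (density N t : ℂ) := by
          rw [sub_mul, Finset.sum_mul]
          congr 1
          exact Finset.sum_congr rfl fun k _ => by ring
      _ = _ := by rw [h]; ring
  rw [hcongr, integral_const_mul, norm_mul, norm_inv, norm_pow]
  refine mul_le_mul_of_nonneg_left ?_ (by positivity)
  rw [← integral_pow_mul_density hN, ← integral_const_mul]
  refine norm_integral_le_of_norm_le ((integrableOn_pow_mul_density hN K).const_mul _) ?_
  filter_upwards [hb, ae_restrict_mem measurableSet_Ici] with t ht ht0
  rw [norm_mul, Complex.norm_real, Real.norm_of_nonneg
    (mul_nonneg (pow_nonneg ht0 K) (density_nonneg N t))]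
  exact mul_le_mul_of_nonneg_right ht (mul_nonneg (pow_nonneg ht0 K) (density_nonneg N t))

end Moments

/-! ### Genus coefficients and growth estimates -/

section GenusCoefficients

/-- The coefficient of `N ^ (1 - 2 g)` in the `k`-th moment of the one-point density. -/
def genusCoeff : ℕ → ℕ → ℝ
  | 0, 0 => 1
  | 0, _ + 1 => 0
  | 1, 0 => 1
  | 1, _ + 1 => 0
  | k + 2, 0 => 2 * (2 * k + 3) * genusCoeff (k + 1) 0 / (k + 3)
  | k + 2, g + 1 => (2 * (2 * k + 3) * genusCoeff (k + 1) (g + 1) +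
      ((k : ℝ) + 1) ^ 2 * k * genusCoeff k g) / (k + 3)

lemma genusCoeff_recurrence_zero (k : ℕ) :
    ((k : ℝ) + 3) * genusCoeff (k + 2) 0 = 2 * (2 * k + 3) * genusCoeff (k + 1) 0 := by
  rw [genusCoeff]
  field_simp

lemma genusCoeff_recurrence (k g : ℕ) :
    ((k : ℝ) + 3) * genusCoeff (k + 2) (g + 1) = 2 * (2 * k + 3) * genusCoeff (k + 1) (g + 1) +
      ((k : ℝ) + 1) ^ 2 * k * genusCoeff k g := by
  conv_lhs => rw [genusCoeff]
  field_simp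

/-- Raising g by one costs two steps in k, and the factor k kills the first attempt at k = 0. Hence
W₁^{(g)} starts no earlier than x^{-1-2g}, and C_0^{(g)} = 0 for g ≥ 1. -/
lemma genusCoeff_eq_zero (k : ℕ) : ∀ g : ℕ, k ≤ 2 * g → 1 ≤ g → genusCoeff k g = 0 := by
  induction k using Nat.twoStepInduction with
  | zero => rintro (_ | g) _ h; · omega
            rw [genusCoeff]
  | one => rintro (_ | g) _ h; · omega
           rw [genusCoeff]
  | more k ih0 ih1 =>
    rintro (_ | g) hk h
    · omega
    rw [genusCoeff, ih1 _ (by omega) h]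
    rcases Nat.eq_zero_or_pos g with rfl | hg
    · obtain rfl : k = 0 := by omega
      simp
    · rw [ih0 _ (by omega) hg]
      simp

/-- One step of the moment recursion, as an estimate. -/
lemma step_bound {r' r s A B ε : ℝ} {k : ℕ} (hε : 0 ≤ ε)
    (h : ((k : ℝ) + 3) * r' = 2 * (2 * k + 3) * r + ε * (((k : ℝ) + 1) ^ 2 * k * s))
    (hr : 0 ≤ r ∧ r ≤ A) (hs : 0 ≤ s ∧ s ≤ B) :
    0 ≤ r' ∧ r' ≤ 4 * A + ε * (((k : ℝ) + 1) ^ 2 * B) := by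
  have hk : (0 : ℝ) < (k : ℝ) + 3 := by positivity
  have hA : 0 ≤ A := hr.1.trans hr.2
  have hB : 0 ≤ B := hs.1.trans hs.2
  constructor
  · refine nonneg_of_mul_nonneg_right ?_ hk
    rw [h]
    have := hr.1
    have := hs.1
    positivity
  · refine le_of_mul_le_mul_left ?_ hk
    rw [h]
    have h1 : 2 * (2 * (k : ℝ) + 3) * r ≤ 2 * (2 * (k : ℝ) + 3) * A :=
      mul_le_mul_of_nonneg_left hr.2 (by positivity)
    have h2 : ε * (((k : ℝ) + 1) ^ 2 * k * s) ≤ ε * (((k : ℝ) + 1) ^ 2 * k * B) := by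
      have := hs.2
      gcongr
    have h3 : 0 ≤ ε * (((k : ℝ) + 1) ^ 2 * B) := by positivity
    nlinarith

/-- Explains the exponent 3 per genus: the factor (k+1)² costs two powers, accumulation over k the
third. -/
lemma add_pow_bound (k j : ℕ) :
    ((k : ℝ) + 1) ^ (3 * (j + 1)) + ((k : ℝ) + 1) ^ 2 * (k : ℝ) ^ (3 * j) ≤
      ((k : ℝ) + 2) ^ (3 * (j + 1)) := by
  have h1 : (k : ℝ) ^ (3 * j) ≤ ((k : ℝ) + 1) ^ (3 * j) := by gcongr; linarith
  have h2 : ((k : ℝ) + 1) ^ (3 * j) ≤ ((k : ℝ) + 2) ^ (3 * j) := by gcongr; norm_num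
  calc _ ≤ ((k : ℝ) + 1) ^ (3 * (j + 1)) + ((k : ℝ) + 1) ^ 2 * ((k : ℝ) + 1) ^ (3 * j) := by gcongr
    _ = ((k : ℝ) + 1) ^ (3 * j) * (((k : ℝ) + 1) ^ 2 * (k + 2)) := by ring
    _ ≤ ((k : ℝ) + 2) ^ (3 * j) * (((k : ℝ) + 2) ^ 2 * (k + 2)) := by gcongr; norm_num
    _ = _ := by ring

lemma genusCoeff_bound (k : ℕ) :
    ∀ g : ℕ, 0 ≤ genusCoeff k g ∧ genusCoeff k g ≤ 4 ^ k * (k : ℝ) ^ (3 * g) := by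
  induction k using Nat.twoStepInduction with
  | zero => rintro (_ | g) <;> simp [genusCoeff]
  | one => rintro (_ | g) <;> simp [genusCoeff]
  | more k ih0 ih1 =>
    rintro (_ | g)
    · have h := step_bound (r' := genusCoeff (k + 2) 0) (k := k) (B := 0) (le_refl (0 : ℝ))
        (by rw [genusCoeff_recurrence_zero]; ring) (ih1 0) ⟨le_rfl, le_rfl⟩
      refine ⟨h.1, h.2.trans (le_of_eq ?_)⟩
      simp
      ring
    · have h := step_bound (r' := genusCoeff (k + 2) (g + 1)) (k := k) zero_le_one
        (by rw [genusCoeff_recurrence]; ring) (ih1 (g + 1)) (ih0 g)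
      refine ⟨h.1, h.2.trans ?_⟩
      have hb := add_pow_bound k g
      have h4 : (0 : ℝ) < 4 ^ k := by positivity
      push_cast
      calc _ = 4 ^ k * (16 * ((k : ℝ) + 1) ^ (3 * (g + 1)) +
            ((k : ℝ) + 1) ^ 2 * (k : ℝ) ^ (3 * g)) := by ring
        _ ≤ 4 ^ k * (16 * (((k : ℝ) + 1) ^ (3 * (g + 1)) +
            ((k : ℝ) + 1) ^ 2 * (k : ℝ) ^ (3 * g))) := by
            have : 0 ≤ ((k : ℝ) + 1) ^ 2 * (k : ℝ) ^ (3 * g) := by positivity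
            gcongr
            linarith
        _ ≤ 4 ^ k * (16 * ((k : ℝ) + 2) ^ (3 * (g + 1))) := by gcongr
        _ = _ := by ring

section Remainder

variable {μ : ℕ → ℝ} {ε : ℝ}

/-- Below `K` the perturbation is at most εK² times an earlier moment, so one step multiplies the
bound by at most 4(1 + εK²). -/
lemma moment_bound (hε : 0 ≤ ε) (h0 : μ 0 = 1) (h1 : μ 1 = 1)
    (hμ : ∀ k : ℕ, ((k : ℝ) + 3) * μ (k + 2) =
      2 * (2 * k + 3) * μ (k + 1) + ε * (((k : ℝ) + 1) ^ 2 * k * μ k))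
    (K k : ℕ) (hk : k ≤ K) : 0 ≤ μ k ∧ μ k ≤ 4 ^ k * (1 + ε * (K : ℝ) ^ 2) ^ k := by
  induction k using Nat.twoStepInduction with
  | zero => simp [h0]
  | one =>
    rw [h1]
    have : 0 ≤ ε * (K : ℝ) ^ 2 := by positivity
    exact ⟨zero_le_one, by linarith⟩
  | more k ih0 ih1 =>
    have h := step_bound hε (hμ k) (ih1 (by omega)) (ih0 (by omega))
    refine ⟨h.1, h.2.trans ?_⟩
    set a := 1 + ε * (K : ℝ) ^ 2 with ha
    have ha1 : 1 ≤ a := by rw [ha]; linarith [show 0 ≤ ε * (K : ℝ) ^ 2 by positivity]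
    have ha0 : 0 ≤ a := by linarith
    have hkK : (k : ℝ) + 1 ≤ K := by exact_mod_cast (by omega : k + 1 ≤ K)
    have hp : a ^ k ≤ a ^ (k + 1) := pow_le_pow_right₀ ha1 (by omega)
    calc _ ≤ 4 * (4 ^ (k + 1) * a ^ (k + 1)) + ε * ((K : ℝ) ^ 2 * (4 ^ k * a ^ (k + 1))) := by
          gcongr
      _ = 4 ^ k * a ^ (k + 1) * (16 + ε * (K : ℝ) ^ 2) := by ring
      _ ≤ 4 ^ k * a ^ (k + 1) * (16 * (1 + ε * (K : ℝ) ^ 2)) := by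
          have : 0 ≤ ε * (K : ℝ) ^ 2 := by positivity
          gcongr
          linarith
      _ = _ := by rw [← ha]; ring

/-- The remainder after `j` terms of the genus expansion of a moment. -/
def genusRemainder (μ : ℕ → ℝ) (ε : ℝ) (j k : ℕ) : ℝ :=
  μ k - ∑ g ∈ Finset.range j, ε ^ g * genusCoeff k g

/-- The ε-term shifts the genus by one, so the remainder of order j+1 obeys the moment recursion
with the remainder of order j as source. This drives the induction on `j` below. -/
lemma genusRemainder_recurrence
    (hμ : ∀ k : ℕ, ((k : ℝ) + 3) * μ (k + 2) =
      2 * (2 * k + 3) * μ (k + 1) + ε * (((k : ℝ) + 1) ^ 2 * k * μ k)) (j k : ℕ) :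
    ((k : ℝ) + 3) * genusRemainder μ ε (j + 1) (k + 2) =
      2 * (2 * k + 3) * genusRemainder μ ε (j + 1) (k + 1) +
        ε * (((k : ℝ) + 1) ^ 2 * k * genusRemainder μ ε j k) := by
  have hs : ((k : ℝ) + 3) * ∑ g ∈ Finset.range j, ε ^ (g + 1) * genusCoeff (k + 2) (g + 1) =
      2 * (2 * k + 3) * ∑ g ∈ Finset.range j, ε ^ (g + 1) * genusCoeff (k + 1) (g + 1) +
        ε * (((k : ℝ) + 1) ^ 2 * k * ∑ g ∈ Finset.range j, ε ^ g * genusCoeff k g) := by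
    simp only [Finset.mul_sum, ← Finset.sum_add_distrib]
    refine Finset.sum_congr rfl fun g _ => ?_
    linear_combination ε ^ (g + 1) * genusCoeff_recurrence k g
  simp only [genusRemainder, Finset.sum_range_succ' _ j, pow_zero, one_mul]
  linear_combination hμ k - hs - genusCoeff_recurrence_zero k

lemma genusRemainder_bound (hε : 0 ≤ ε) (h0 : μ 0 = 1) (h1 : μ 1 = 1)
    (hμ : ∀ k : ℕ, ((k : ℝ) + 3) * μ (k + 2) =
      2 * (2 * k + 3) * μ (k + 1) + ε * (((k : ℝ) + 1) ^ 2 * k * μ k))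
    (K : ℕ) (j : ℕ) : ∀ k ≤ K, 0 ≤ genusRemainder μ ε j k ∧
      genusRemainder μ ε j k ≤
        Real.exp (ε * (K : ℝ) ^ 3) * (4 ^ k * (ε ^ j * (k : ℝ) ^ (3 * j))) := by
  set E := Real.exp (ε * (K : ℝ) ^ 3) with hE
  have hE0 : 0 < E := Real.exp_pos _
  induction j with
  | zero =>
    intro k hk
    have h := moment_bound hε h0 h1 hμ K k hk
    simp only [genusRemainder, Finset.range_zero, Finset.sum_empty, sub_zero, mul_zero, pow_zero,
      mul_one]
    refine ⟨h.1, h.2.trans ?_⟩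
    rw [mul_comm]
    gcongr
    have hb : 0 ≤ ε * (K : ℝ) ^ 2 := by positivity
    calc (1 + ε * (K : ℝ) ^ 2) ^ k ≤ (1 + ε * (K : ℝ) ^ 2) ^ K :=
          pow_le_pow_right₀ (by linarith) hk
      _ ≤ Real.exp (ε * (K : ℝ) ^ 2) ^ K := by
          gcongr
          rw [add_comm]
          exact Real.add_one_le_exp _
      _ = E := by rw [hE, ← Real.exp_nat_mul]; congr 1; ring
  | succ j ih =>
    have c0 : ∀ g, genusCoeff 0 (g + 1) = 0 := fun g => by rw [genusCoeff]
    have c1 : ∀ g, genusCoeff 1 (g + 1) = 0 := fun g => by rw [genusCoeff]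
    have c00 : genusCoeff 0 0 = 1 := by rw [genusCoeff]
    have c10 : genusCoeff 1 0 = 1 := by rw [genusCoeff]
    intro k
    induction k using Nat.twoStepInduction with
    | zero =>
      intro _
      simp [genusRemainder, Finset.sum_range_succ', c0, c00, h0]
    | one =>
      intro _
      have : genusRemainder μ ε (j + 1) 1 = 0 := by
        simp [genusRemainder, Finset.sum_range_succ', c1, c10, h1]
      rw [this]
      exact ⟨le_rfl, by positivity⟩
    | more k ih0 ih1 =>
      intro hk
      have h := step_bound hε (genusRemainder_recurrence hμ j k) (ih1 (by omega)) (ih k (by omega))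
      refine ⟨h.1, h.2.trans ?_⟩
      have hb := add_pow_bound k j
      push_cast
      have hn : 0 ≤ ((k : ℝ) + 1) ^ 2 * (k : ℝ) ^ (3 * j) := by positivity
      calc _ = E * (4 ^ k * (ε ^ (j + 1) * (16 * ((k : ℝ) + 1) ^ (3 * (j + 1)) +
            ((k : ℝ) + 1) ^ 2 * (k : ℝ) ^ (3 * j)))) := by ring
        _ ≤ E * (4 ^ k * (ε ^ (j + 1) * (16 * ((k : ℝ) + 2) ^ (3 * (j + 1))))) := by
            gcongr
            linarith
        _ = _ := by ring

end Remainder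

end GenusCoefficients

/-! ### Existence of the genus expansion for |x| > 4 -/

section Expansion

/-- The `g`-th term of the genus expansion of the one-loop mean. -/
def genusTerm (g : ℕ) (x : ℂ) : ℂ :=
  ∑' k : ℕ, (genusCoeff k g : ℂ) * (x ^ (k + 1))⁻¹

lemma summable_pow_mul_geometric {x : ℂ} (hx : 4 < ‖x‖) (p : ℕ) :
    Summable fun k : ℕ => (k : ℝ) ^ p * (4 / ‖x‖) ^ k := by
  have h0 : 0 < ‖x‖ := by linarith
  refine summable_pow_mul_geometric_of_norm_lt_one p ?_
  rw [Real.norm_of_nonneg (by positivity), div_lt_one h0]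
  exact hx

/-- The sum `∑ₖ k ^ p (4 / |x|) ^ k`, which majorises the series occurring in the expansion. -/
def majorant (x : ℂ) (p : ℕ) : ℝ :=
  ∑' k : ℕ, (k : ℝ) ^ p * (4 / ‖x‖) ^ k

lemma majorant_nonneg (x : ℂ) (p : ℕ) : 0 ≤ majorant x p :=
  tsum_nonneg fun _ => by positivity

lemma norm_genusCoeff_mul_le {x : ℂ} (hx : 4 < ‖x‖) (g k : ℕ) :
    ‖(genusCoeff k g : ℂ) * (x ^ (k + 1))⁻¹‖ ≤ (k : ℝ) ^ (3 * g) * (4 / ‖x‖) ^ k := by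
  have h0 : 0 < ‖x‖ := by linarith
  have hb := genusCoeff_bound k g
  rw [norm_mul, Complex.norm_real, Real.norm_of_nonneg hb.1, norm_inv, norm_pow, div_pow]
  calc _ ≤ (4 ^ k * (k : ℝ) ^ (3 * g)) * (‖x‖ ^ k)⁻¹ := by
        gcongr
        · exact hb.2
        · linarith
        · omega
    _ = _ := by ring

lemma summable_genusCoeff_mul {x : ℂ} (hx : 4 < ‖x‖) (g : ℕ) :
    Summable fun k : ℕ => (genusCoeff k g : ℂ) * (x ^ (k + 1))⁻¹ :=
  Summable.of_norm_bounded (summable_pow_mul_geometric hx (3 * g)) (norm_genusCoeff_mul_le hx g)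

lemma hasSum_genusTerm {x : ℂ} (hx : 4 < ‖x‖) (g : ℕ) :
    HasSum (fun n : ℕ => (genusCoeff (n + 2 * g) g : ℂ) * x ^ (-1 - 2 * (g : ℤ) - (n : ℤ)))
      (genusTerm g x) := by
  have h : HasSum _ (genusTerm g x) := (summable_genusCoeff_mul hx g).hasSum
  have hz : ∑ k ∈ Finset.range (2 * g), (genusCoeff k g : ℂ) * (x ^ (k + 1))⁻¹ = 0 := by
    refine Finset.sum_eq_zero fun k hk => ?_
    have hk' := Finset.mem_range.1 hk
    rw [genusCoeff_eq_zero k g (by omega) (by omega)]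
    simp
  have h2 := (hasSum_nat_add_iff' (f := fun k : ℕ => (genusCoeff k g : ℂ) * (x ^ (k + 1))⁻¹)
    (2 * g)).2 h
  rw [hz, sub_zero] at h2
  refine h2.congr_fun fun n => ?_
  rw [← zpow_natCast x, ← zpow_neg]
  push_cast
  ring_nf

/-- On the tail k ≥ K, inserting (k/K)^J ≥ 1 gains K^{-J} at the price of a higher power of k in the
majorant. -/
lemma tail_bound {x : ℂ} (hx : 4 < ‖x‖) (g K J : ℕ) (hK : 0 < K) :
    ‖genusTerm g x - ∑ k ∈ Finset.range K, (genusCoeff k g : ℂ) * (x ^ (k + 1))⁻¹‖ ≤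
      ((K : ℝ) ^ J)⁻¹ * majorant x (3 * g + J) := by
  have hs := summable_pow_mul_geometric hx (3 * g + J)
  have hKJ : (0 : ℝ) < (K : ℝ) ^ J := by positivity
  have h := (hasSum_nat_add_iff' (f := fun k : ℕ => (genusCoeff k g : ℂ) * (x ^ (k + 1))⁻¹)
    K).2 (summable_genusCoeff_mul hx g).hasSum
  rw [genusTerm, ← h.tsum_eq]
  have hsK := (summable_nat_add_iff K).2 hs
  calc _ ≤ ∑' n : ℕ, ((K : ℝ) ^ J)⁻¹ *
        (((n + K : ℕ) : ℝ) ^ (3 * g + J) * (4 / ‖x‖) ^ (n + K)) := by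
        refine tsum_of_norm_bounded (hsK.mul_left _).hasSum fun n => ?_
        refine (norm_genusCoeff_mul_le hx g (n + K)).trans ?_
        have : (K : ℝ) ^ J ≤ ((n + K : ℕ) : ℝ) ^ J := by gcongr; omega
        rw [inv_mul_eq_div, le_div_iff₀ hKJ, pow_add _ (3 * g) J]
        calc _ = ((n + K : ℕ) : ℝ) ^ (3 * g) * (K : ℝ) ^ J * (4 / ‖x‖) ^ (n + K) := by ring
          _ ≤ _ := by gcongr
    _ = ((K : ℝ) ^ J)⁻¹ * ∑' n : ℕ,
        (((n + K : ℕ) : ℝ) ^ (3 * g + J) * (4 / ‖x‖) ^ (n + K)) := tsum_mul_left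
    _ ≤ _ := by
        refine mul_le_mul_of_nonneg_left ?_ (by positivity)
        have := hs.sum_add_tsum_nat_add K
        rw [majorant, ← this]
        have : 0 ≤ ∑ k ∈ Finset.range K, (k : ℝ) ^ (3 * g + J) * (4 / ‖x‖) ^ k :=
          Finset.sum_nonneg fun _ _ => by positivity
        linarith

lemma geometric_le {x : ℂ} (hx : 4 < ‖x‖) (K J : ℕ) (hK : 0 < K) :
    (4 / ‖x‖) ^ K ≤ ((K : ℝ) ^ J)⁻¹ * majorant x J := by
  have hKJ : (0 : ℝ) < (K : ℝ) ^ J := by positivity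
  rw [inv_mul_eq_div, le_div_iff₀ hKJ, mul_comm]
  exact (summable_pow_mul_geometric hx J).le_tsum K fun _ _ => by positivity

/-- The cut-off K = ⌊√N⌋ + 1. The lower bound makes powers of K⁻¹ beat any power of N⁻¹; the upper
one gives εK³ ≤ 8, the source of `Real.exp 8`. -/
lemma exists_truncation (N : ℕ) (hN : 0 < N) :
    ∃ K : ℕ, 0 < K ∧ N ≤ K ^ 2 ∧ K ^ 3 ≤ 8 * N ^ 2 := by
  refine ⟨Nat.sqrt N + 1, by omega, (Nat.lt_succ_sqrt' N).le, ?_⟩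
  have h1 : Nat.sqrt N ^ 2 ≤ N := Nat.sqrt_le' N
  have h2 : 1 ≤ Nat.sqrt N := Nat.sqrt_pos.2 hN
  set s := Nat.sqrt N
  calc (s + 1) ^ 3 ≤ (2 * s) ^ 3 := by gcongr; omega
    _ = 8 * (s ^ 2 * s) := by ring
    _ ≤ 8 * (s ^ 2 * s ^ 2) := by gcongr; nlinarith
    _ ≤ 8 * (N * N) := by gcongr
    _ = _ := by ring

lemma natCast_zpow_one_sub {N : ℕ} (hN : 0 < N) (g : ℕ) :
    (N : ℂ) ^ (1 - 2 * (g : ℤ)) = N * (((N : ℂ) ^ 2)⁻¹) ^ g := by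
  have : (N : ℂ) ≠ 0 := by exact_mod_cast hN.ne'
  rw [zpow_sub₀ this, zpow_one, zpow_mul, zpow_natCast, inv_pow, div_eq_mul_inv]
  rfl

/-- Three errors: truncation of the Stieltjes transform, remainders of the moments below `K`, and
tails of the genus series. -/
lemma genusExpansion_error_eq {N : ℕ} (x : ℂ) (G K : ℕ) :
    oneLoopMean N x - ∑ g ∈ Finset.range (G + 1), N * (((N : ℂ) ^ 2)⁻¹) ^ g * genusTerm g x =
      (oneLoopMean N x -
        N * ∑ k ∈ Finset.range K, (normalizedMoment N k : ℂ) * (x ^ (k + 1))⁻¹) +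
      N * ∑ k ∈ Finset.range K,
        (genusRemainder (normalizedMoment N) ((N : ℝ) ^ 2)⁻¹ (G + 1) k : ℂ) * (x ^ (k + 1))⁻¹ -
      ∑ g ∈ Finset.range (G + 1), N * (((N : ℂ) ^ 2)⁻¹) ^ g *
        (genusTerm g x - ∑ k ∈ Finset.range K, (genusCoeff k g : ℂ) * (x ^ (k + 1))⁻¹) := by
  have h : ∑ k ∈ Finset.range K,
      (genusRemainder (normalizedMoment N) ((N : ℝ) ^ 2)⁻¹ (G + 1) k : ℂ) * (x ^ (k + 1))⁻¹ =
      ∑ k ∈ Finset.range K, (normalizedMoment N k : ℂ) * (x ^ (k + 1))⁻¹ -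
      ∑ g ∈ Finset.range (G + 1), (((N : ℂ) ^ 2)⁻¹) ^ g *
        ∑ k ∈ Finset.range K, (genusCoeff k g : ℂ) * (x ^ (k + 1))⁻¹ := by
    simp only [Finset.mul_sum]
    rw [Finset.sum_comm, ← Finset.sum_sub_distrib]
    refine Finset.sum_congr rfl fun k _ => ?_
    simp only [genusRemainder]
    push_cast
    rw [sub_mul, Finset.sum_mul]
    simp only [mul_assoc]
  rw [h]
  simp only [mul_sub, Finset.sum_sub_distrib, mul_assoc, ← Finset.mul_sum]
  ring

lemma genusExpansion_error_bound {x : ℂ} (hx4 : 4 < ‖x‖) {δ : ℝ} (hδ : 0 < δ)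
    (hx : ∀ t : ℝ, 0 ≤ t → δ ≤ ‖x - t‖) (G N : ℕ) (hN : 0 < N) :
    ‖oneLoopMean N x -
        ∑ g ∈ Finset.range (G + 1), N * (((N : ℂ) ^ 2)⁻¹) ^ g * genusTerm g x‖ ≤
      (δ⁻¹ * Real.exp 8 * majorant x (4 * (G + 1)) + Real.exp 8 * majorant x (3 * (G + 1)) +
        ∑ g ∈ Finset.range (G + 1), majorant x (3 * g + 4 * (G + 1))) *
      (N * (((N : ℝ) ^ 2)⁻¹) ^ (G + 1)) := by
  obtain ⟨K, hK, hNK, hKN⟩ := exists_truncation N hN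
  have h0 : 0 < ‖x‖ := by linarith
  have hN' : (0 : ℝ) < N := by positivity
  set ε : ℝ := ((N : ℝ) ^ 2)⁻¹ with hε
  have hε0 : 0 < ε := by positivity
  have hε1 : ε ≤ 1 := inv_le_one_of_one_le₀ (one_le_pow₀ (by exact_mod_cast hN))
  -- The exponent 4(G+1) is what N ≤ K² requires to reach ε^{G+1} = N^{-2(G+1)}.
  have hKε : ((K : ℝ) ^ (4 * (G + 1)))⁻¹ ≤ ε ^ (G + 1) := by
    rw [hε, inv_pow]
    refine inv_anti₀ (by positivity) ?_
    have : (N : ℝ) ≤ (K : ℝ) ^ 2 := by exact_mod_cast hNK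
    calc ((N : ℝ) ^ 2) ^ (G + 1) ≤ (((K : ℝ) ^ 2) ^ 2) ^ (G + 1) := by gcongr
      _ = _ := by rw [← pow_mul, ← pow_mul]; congr 1; ring
  have hE : Real.exp (ε * (K : ℝ) ^ 3) ≤ Real.exp 8 := by
    refine Real.exp_le_exp.2 ?_
    rw [hε, inv_mul_eq_div, div_le_iff₀ (by positivity)]
    exact_mod_cast hKN
  have hR := fun j => genusRemainder_bound hε0.le (normalizedMoment_zero_right hN)
    (normalizedMoment_one_right hN) (normalizedMoment_recurrence hN) K j
  have b1 : ‖oneLoopMean N x -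
      N * ∑ k ∈ Finset.range K, (normalizedMoment N k : ℂ) * (x ^ (k + 1))⁻¹‖ ≤
      δ⁻¹ * Real.exp 8 * majorant x (4 * (G + 1)) * (N * ε ^ (G + 1)) := by
    refine (norm_oneLoopMean_sub_sum_le hN hδ hx K).trans ?_
    have hm := (hR 0 K le_rfl).2
    simp only [genusRemainder, Finset.range_zero, Finset.sum_empty, sub_zero, mul_zero, pow_zero,
      mul_one] at hm
    have hM := majorant_nonneg x (4 * (G + 1))
    calc _ ≤ (‖x‖ ^ K)⁻¹ * (δ⁻¹ * (N * (Real.exp 8 * 4 ^ K))) := by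
          gcongr
          exact hm.trans (by gcongr)
      _ = δ⁻¹ * Real.exp 8 * N * (4 / ‖x‖) ^ K := by rw [div_pow]; ring
      _ ≤ δ⁻¹ * Real.exp 8 * N * (ε ^ (G + 1) * majorant x (4 * (G + 1))) := by
          gcongr
          exact (geometric_le hx4 K (4 * (G + 1)) hK).trans (by gcongr)
      _ = _ := by ring
  have b2 : ‖(N : ℂ) * ∑ k ∈ Finset.range K,
      (genusRemainder (normalizedMoment N) ε (G + 1) k : ℂ) * (x ^ (k + 1))⁻¹‖ ≤
      Real.exp 8 * majorant x (3 * (G + 1)) * (N * ε ^ (G + 1)) := by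
    rw [norm_mul, Complex.norm_natCast]
    have hs : ‖∑ k ∈ Finset.range K,
        (genusRemainder (normalizedMoment N) ε (G + 1) k : ℂ) * (x ^ (k + 1))⁻¹‖ ≤
        Real.exp 8 * ε ^ (G + 1) * majorant x (3 * (G + 1)) := by
      calc _ ≤ ∑ k ∈ Finset.range K, Real.exp 8 * ε ^ (G + 1) *
            ((k : ℝ) ^ (3 * (G + 1)) * (4 / ‖x‖) ^ k) := by
            refine norm_sum_le_of_le _ fun k hk => ?_
            have hb := hR (G + 1) k (Finset.mem_range.1 hk).le
            rw [norm_mul, Complex.norm_real, Real.norm_of_nonneg hb.1, norm_inv, norm_pow]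
            calc _ ≤ (Real.exp 8 * (4 ^ k * (ε ^ (G + 1) * (k : ℝ) ^ (3 * (G + 1))))) *
                  (‖x‖ ^ k)⁻¹ := by
                  gcongr
                  · exact hb.2.trans (by gcongr)
                  · linarith
                  · omega
              _ = _ := by rw [div_pow]; ring
        _ = Real.exp 8 * ε ^ (G + 1) * ∑ k ∈ Finset.range K,
            ((k : ℝ) ^ (3 * (G + 1)) * (4 / ‖x‖) ^ k) := by rw [Finset.mul_sum]
        _ ≤ _ := by
            gcongr
            exact (summable_pow_mul_geometric hx4 _).sum_le_tsum _ fun _ _ => by positivity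
    calc _ ≤ (N : ℝ) * (Real.exp 8 * ε ^ (G + 1) * majorant x (3 * (G + 1))) := by gcongr
      _ = _ := by ring
  have b3 : ‖∑ g ∈ Finset.range (G + 1), (N : ℂ) * (((N : ℂ) ^ 2)⁻¹) ^ g *
      (genusTerm g x - ∑ k ∈ Finset.range K, (genusCoeff k g : ℂ) * (x ^ (k + 1))⁻¹)‖ ≤
      (∑ g ∈ Finset.range (G + 1), majorant x (3 * g + 4 * (G + 1))) * (N * ε ^ (G + 1)) := by
    rw [Finset.sum_mul]
    refine norm_sum_le_of_le _ fun g _ => ?_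
    have hM := majorant_nonneg x (3 * g + 4 * (G + 1))
    have hn : ‖(((N : ℂ) ^ 2)⁻¹) ^ g‖ ≤ 1 := by
      rw [norm_pow, norm_inv, norm_pow, Complex.norm_natCast, ← hε]
      exact pow_le_one₀ hε0.le hε1
    rw [norm_mul, norm_mul, Complex.norm_natCast]
    calc _ ≤ (N : ℝ) * 1 * (ε ^ (G + 1) * majorant x (3 * g + 4 * (G + 1))) := by
          gcongr
          exact (tail_bound hx4 g K (4 * (G + 1)) hK).trans (by gcongr)
      _ = _ := by ring
  rw [genusExpansion_error_eq x G K]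
  refine (norm_sub_le _ _).trans ?_
  refine (add_le_add ((norm_add_le _ _).trans (add_le_add b1 b2)) b3).trans (le_of_eq ?_)
  ring

lemma isGenusExpansion_genusTerm : IsGenusExpansion 4 genusTerm := by
  intro x hx G
  obtain ⟨δ, hδ, hd⟩ := exists_dist_pos_of_mem_cutNhd hx
  refine Asymptotics.IsBigO.of_bound (δ⁻¹ * Real.exp 8 * majorant x (4 * (G + 1)) +
    Real.exp 8 * majorant x (3 * (G + 1)) +
      ∑ g ∈ Finset.range (G + 1), majorant x (3 * g + 4 * (G + 1))) ?_
  filter_upwards [Filter.eventually_gt_atTop 0] with N hN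
  have h := genusExpansion_error_bound hx.1 hδ hd G N hN
  simp only [natCast_zpow_one_sub hN]
  refine h.trans (le_of_eq ?_)
  congr 1
  have hN' : (N : ℝ) ≠ 0 := by positivity
  rw [Real.norm_of_nonneg (by positivity), ← zpow_natCast, ← zpow_natCast, ← zpow_neg,
    ← zpow_mul, ← zpow_one_add₀ hN']
  congr 1
  push_cast
  ring

lemma isCoefficients_genusTerm :
    IsCoefficients 4 genusTerm fun g n => (genusCoeff (n + 2 * g) g : ℂ) :=
  fun g _ hx => hasSum_genusTerm hx.1 g

end Expansion

/-! ### Uniqueness of the expansions and the closed form for n = 1 -/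

section Uniqueness

open Filter Topology

lemma cutNhd_anti {R R' : ℝ} (h : R ≤ R') : cutNhd R' ⊆ cutNhd R :=
  fun _ hx => ⟨h.trans_lt hx.1, hx.2⟩

/-- The terms of a genus expansion are unique. -/
lemma IsGenusExpansion.unique {R : ℝ} {W W' : ℕ → ℂ → ℂ} (hW : IsGenusExpansion R W)
    (hW' : IsGenusExpansion R W') {x : ℂ} (hx : x ∈ cutNhd R) (g : ℕ) : W g x = W' g x := by
  induction g using Nat.strong_induction_on with
  | _ g ih =>
    have h := (hW x hx g).sub (hW' x hx g)
    have hc : (fun N : ℕ => (N : ℂ) ^ (1 - 2 * (g : ℤ)) * (W' g x - W g x)) =O[atTop]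
        fun N : ℕ => (N : ℝ) ^ (-1 - 2 * (g : ℤ)) := by
      refine h.congr_left fun N => ?_
      have : ∑ k ∈ Finset.range g, (N : ℂ) ^ (1 - 2 * (k : ℤ)) * W k x =
          ∑ k ∈ Finset.range g, (N : ℂ) ^ (1 - 2 * (k : ℤ)) * W' k x :=
        Finset.sum_congr rfl fun k hk => by rw [ih k (Finset.mem_range.1 hk)]
      rw [Finset.sum_range_succ, Finset.sum_range_succ, this]
      ring
    -- Multiplying by N^{2g-1} makes the difference a constant that is O(N⁻²), hence zero.
    have hb : (fun N : ℕ => (N : ℝ) ^ (2 * (g : ℤ) - 1)) =O[atTop]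
        fun N : ℕ => (N : ℝ) ^ (2 * (g : ℤ) - 1) := Asymptotics.isBigO_refl _ _
    have hm := hb.smul hc
    have h0 : Tendsto (fun N : ℕ => ((N : ℝ) ^ 2)⁻¹) atTop (𝓝 0) :=
      ((tendsto_pow_atTop two_ne_zero).comp tendsto_natCast_atTop_atTop).inv_tendsto_atTop
    have hconst : (fun _ : ℕ => W' g x - W g x) =O[atTop] fun N : ℕ => ((N : ℝ) ^ 2)⁻¹ := by
      refine (hm.congr' ?_ ?_)
      · filter_upwards [eventually_gt_atTop 0] with N hN
        have hN' : (N : ℂ) ≠ 0 := by exact_mod_cast hN.ne'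
        rw [Complex.real_smul]
        push_cast
        rw [← mul_assoc, ← zpow_add₀ hN']
        simp
      · filter_upwards [eventually_gt_atTop 0] with N hN
        have hN' : (N : ℝ) ≠ 0 := by exact_mod_cast hN.ne'
        rw [smul_eq_mul, ← zpow_add₀ hN', ← zpow_natCast, ← zpow_neg]
        congr 1
        push_cast
        ring
    have ht : Tendsto (fun _ : ℕ => W' g x - W g x) atTop (𝓝 0) := hconst.trans_tendsto h0
    exact (sub_eq_zero.1 (tendsto_nhds_unique tendsto_const_nhds ht)).symm

/-- A power series that vanishes on a sequence of points tending to `0` is zero. -/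
lemma powerSeries_coeff_eq_zero {d : ℕ → ℂ} {r : ℝ} (hr : 0 < r)
    (h : ∀ t : ℝ, 0 < t → t < r → HasSum (fun n => d n * (-(t : ℂ)) ^ n) 0) (n : ℕ) : d n = 0 := by
  set p := FormalMultilinearSeries.ofScalars ℂ d with hp
  have hrad : 0 < p.radius := by
    have hs := (h (r / 2) (by positivity) (by linarith)).summable
    have ht := hs.tendsto_atTop_zero.norm
    let ρ : NNReal := ⟨r / 2, by positivity⟩
    -- Convergence at -r/2 makes the terms tend to 0 there, so the radius is at least r/2.
    have hle : (ρ : ENNReal) ≤ p.radius := by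
      refine p.le_radius_of_tendsto (l := 0) ?_
      rw [norm_zero] at ht
      refine ht.congr fun n => ?_
      rw [hp, FormalMultilinearSeries.ofScalars_norm, norm_mul, norm_pow, norm_neg,
        Complex.norm_real, Real.norm_of_nonneg (by positivity)]
      rfl
    refine lt_of_lt_of_le ?_ hle
    exact ENNReal.coe_pos.2 (show (0 : ℝ) < r / 2 by positivity)
  have hf := p.hasFPowerSeriesOnBall hrad
  have hsum : ∀ t : ℝ, 0 < t → t < r → p.sum (-(t : ℂ)) = 0 := by
    intro t h0 h1
    rw [FormalMultilinearSeries.sum, ← (h t h0 h1).tsum_eq]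
    refine tsum_congr fun n => ?_
    rw [hp, FormalMultilinearSeries.ofScalars_apply_eq, smul_eq_mul]
  have hfreq : ∃ᶠ z in 𝓝[≠] (0 : ℂ), p.sum z = 0 := by
    have hlim : Tendsto (fun t : ℝ => -(t : ℂ)) (𝓝[>] 0) (𝓝[≠] 0) := by
      refine tendsto_nhdsWithin_of_tendsto_nhds_of_eventually_within _ ?_ ?_
      · have : Continuous fun t : ℝ => -(t : ℂ) := by fun_prop
        simpa using (this.tendsto 0).mono_left nhdsWithin_le_nhds
      · filter_upwards [self_mem_nhdsWithin] with t ht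
        simpa using (ne_of_gt ht : t ≠ 0)
    refine hlim.frequently (Eventually.frequently ?_)
    filter_upwards [Ioo_mem_nhdsGT hr] with t ht
    exact hsum t ht.1 ht.2
  have hz := hf.analyticAt.frequently_zero_iff_eventually_zero.1 hfreq
  have hp0 : p = 0 := HasFPowerSeriesAt.eq_zero (hf.hasFPowerSeriesAt.congr hz)
  have : p.coeff n = 0 := by rw [hp0]; rfl
  rwa [hp, FormalMultilinearSeries.coeff_ofScalars] at this

lemma neg_inv_mem_cutNhd {R t : ℝ} (ht : 0 < t) (hR : R < t⁻¹) : -((t : ℂ))⁻¹ ∈ cutNhd R := by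
  refine ⟨?_, fun s hs h => ?_⟩
  · rwa [norm_neg, norm_inv, Complex.norm_real, Real.norm_of_nonneg ht.le]
  · have : -t⁻¹ = s := by exact_mod_cast h
    have := inv_pos.2 ht
    linarith

/-- The coefficients of the expansions at infinity are unique. -/
lemma IsCoefficients.unique {R : ℝ} {W : ℕ → ℂ → ℂ} {C C' : ℕ → ℕ → ℂ}
    (hC : IsCoefficients R W C) (hC' : IsCoefficients R W C') (g n : ℕ) : C g n = C' g n := by
  -- The maximum with 1 guards against R ≤ 0.
  have hr : (0 : ℝ) < (max R 1)⁻¹ := by positivity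
  refine sub_eq_zero.1 (powerSeries_coeff_eq_zero (d := fun n => C g n - C' g n) hr ?_ n)
  intro t h0 h1
  have hR : R < t⁻¹ := (le_max_left R 1).trans_lt ((lt_inv_comm₀ h0 (by positivity)).1 h1)
  have hx := neg_inv_mem_cutNhd h0 hR
  have ht : (t : ℂ) ≠ 0 := by exact_mod_cast h0.ne'
  -- At x = -1/t, on the negative axis and so off the cut, multiplying by x^{1+2g} leaves a power
  -- series in 1/x = -t.
  have h := ((hC g _ hx).sub (hC' g _ hx)).mul_left ((-((t : ℂ))⁻¹) ^ (1 + 2 * (g : ℤ)))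
  rw [sub_self, mul_zero] at h
  refine h.congr_fun ?_
  intro n
  have hx0 : -((t : ℂ))⁻¹ ≠ 0 := neg_ne_zero.2 (inv_ne_zero ht)
  have e : (-((t : ℂ))⁻¹) ^ (1 + 2 * (g : ℤ)) * (-((t : ℂ))⁻¹) ^ (-1 - 2 * (g : ℤ) - (n : ℤ)) =
      (-(t : ℂ)) ^ n := by
    rw [← zpow_add₀ hx0, ← inv_neg, ← zpow_natCast, inv_zpow']
    congr 1
    ring
  rw [← e]
  ring

lemma IsGenusExpansion.mono {R R' : ℝ} (h : R ≤ R') {W : ℕ → ℂ → ℂ} (hW : IsGenusExpansion R W) :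
    IsGenusExpansion R' W :=
  fun x hx => hW x (cutNhd_anti h hx)

/-- Beyond max(R, 4) the given expansion and the constructed one both hold, so their terms and then
their coefficients agree. -/
lemma coefficients_eq {R : ℝ} {W : ℕ → ℂ → ℂ} {C : ℕ → ℕ → ℂ} (hW : IsGenusExpansion R W)
    (hC : IsCoefficients R W C) (g n : ℕ) : C g n = (genusCoeff (n + 2 * g) g : ℂ) := by
  have h1 : IsCoefficients (max R 4) W C := fun g x hx =>
    hC g x (cutNhd_anti (le_max_left R 4) hx)
  have h2 : IsCoefficients (max R 4) W fun g n => (genusCoeff (n + 2 * g) g : ℂ) := by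
    intro g x hx
    rw [(hW.mono (le_max_left R 4)).unique (isGenusExpansion_genusTerm.mono (le_max_right R 4)) hx]
    exact isCoefficients_genusTerm g x (cutNhd_anti (le_max_right R 4) hx)
  exact h1.unique h2 g n

/-- At n = 1 the middle term of the recursion is C_0^{(g+1)} = 0, leaving a two-term recursion in g.
-/
lemma genusCoeff_one_add_two_mul (g : ℕ) :
    genusCoeff (1 + 2 * g) g = 2 ^ g * g ! * (2 * g - 1)‼ / ((g : ℝ) + 1) := by
  induction g with
  | zero => simp [genusCoeff]
  | succ g ih =>
    have h := genusCoeff_recurrence (1 + 2 * g) g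
    rw [genusCoeff_eq_zero (1 + 2 * g + 1) (g + 1) (by omega) (by omega), ih] at h
    -- For g = 0 natural subtraction gives 0‼ = 1, matching the convention (-1)‼ = 1.
    have hd : (2 * (g + 1) - 1)‼ = (2 * g + 1) * (2 * g - 1)‼ := by
      cases g with
      | zero => rfl
      | succ g => exact Nat.doubleFactorial_add_two (2 * g + 1)
    rw [show 1 + 2 * (g + 1) = 1 + 2 * g + 2 by ring, hd, Nat.factorial_succ]
    push_cast at h ⊢
    have hg : (g : ℝ) + 1 ≠ 0 := by positivity
    have hg2 : (g : ℝ) + 1 + 1 ≠ 0 := by positivity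
    field_simp at h ⊢
    refine mul_right_cancel₀ hg ?_
    linear_combination h / 2

end Uniqueness

end Laguerre

end

/-! ### The main theorem -/

theorem mainTheorem1 :
    (∃ (W : ℕ → ℂ → ℂ) (C : ℕ → ℕ → ℂ),
      Laguerre.IsGenusExpansion 4 W ∧ Laguerre.IsCoefficients 4 W C) ∧
    ∀ (R : ℝ) (W : ℕ → ℂ → ℂ) (C : ℕ → ℕ → ℂ),
      Laguerre.IsGenusExpansion R W → Laguerre.IsCoefficients R W C →
        (∀ n g : ℕ, 0 < n → 0 < g →
          ((n : ℂ) + 2 * g + 1) * C g n =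
            ((n : ℂ) + 2 * g - 2) * ((n : ℂ) + 2 * g - 1) ^ 2 * C (g - 1) n +
              2 * (2 * (n : ℂ) + 4 * g - 1) * C g (n - 1)) ∧
        C 0 0 = 1 ∧
        (∀ g : ℕ, 1 ≤ g → C g 0 = 0) ∧
        (∀ g : ℕ, C g 1 = (2 : ℂ) ^ g * (g ! : ℂ) * ((2 * g - 1)‼ : ℂ) / ((g : ℂ) + 1)) := by
  refine ⟨⟨_, _, Laguerre.isGenusExpansion_genusTerm, Laguerre.isCoefficients_genusTerm⟩, ?_⟩
  intro R W C hW hC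
  have hc := Laguerre.coefficients_eq hW hC
  refine ⟨fun n g hn hg => ?_, ?_, fun g hg => ?_, fun g => ?_⟩
  · obtain ⟨n, rfl⟩ : ∃ m, n = m + 1 := ⟨n - 1, by omega⟩
    obtain ⟨g, rfl⟩ : ∃ m, g = m + 1 := ⟨g - 1, by omega⟩
    -- After the shift of both indices, this is the recursion at k = n + 2g − 2 in the original
    -- ones.
    have h := congrArg (fun r : ℝ => (r : ℂ)) (Laguerre.genusCoeff_recurrence (n + 1 + 2 * g) g)
    simp only [hc, add_tsub_cancel_right]
    rw [show n + 1 + 2 * (g + 1) = n + 1 + 2 * g + 2 by ring,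
      show n + 2 * (g + 1) = n + 1 + 2 * g + 1 by ring]
    push_cast at h ⊢
    linear_combination h
  · rw [hc]
    simp [Laguerre.genusCoeff]
  · rw [hc, Laguerre.genusCoeff_eq_zero _ _ (by omega) hg, Complex.ofReal_zero]
  · rw [hc, Laguerre.genusCoeff_one_add_two_mul]
    push_cast
    rfl
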